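/- Let $q:(0,1)\to\mathbb C$ be locally integrable and such that for every $\mu\in\mathbb C$ the equation $-y''+q(x)y=\mu^2y$ on $[0,1]$ has solutions $y_c(\cdot,\mu)$ and $y_s(\cdot,\mu)$ with $y_c(0,\mu)=1$, $y_c'(0,\mu)=0$ and $y_s(0,\mu)=0$, $y_s'(0,\mu)=1$. Here a solution is a differentiable function on $[0,1]$ whose derivative is absolutely continuous on $[0,1]$ and which satisfies the equation almost everywhere. Let $\theta>0$, let $m\ge 2$ be an integer, and put $\sigma=1+m\theta$. With $\frac{\sin z}{z}$ read as $1$ at $z=0$, define for $\mu\in\mathbb C$ $$h_{11}(\mu)=\Big(\tfrac{\sin\theta\mu}{\theta\mu}\Big)^m\big(y_c(1,\mu)-\cos\mu\big),\qquad h_{12}(\mu)=\Big(\tfrac{\sin\theta\mu}{\theta\mu}\Big)^m\big(y_s(1,\mu)-\tfrac{\sin\mu}{\mu}\big),$$ $$h_{21}(\mu)=\Big(\tfrac{\sin\theta\mu}{\theta\mu}\Big)^m\big(y_c'(1,\mu)+\mu\sin\mu\big),\qquad h_{22}(\mu)=\Big(\tfrac{\sin\theta\mu}{\theta\mu}\Big)^m\big(y_s'(1,\mu)-\cos\mu\big).$$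 For $k,l\in\{1,2\}$ and an integer $N\ge 0$ let $$h_{kl}^{[N]}(\mu)=\sum_{j=-N}^{N}h_{kl}(\mu_j)\frac{\sin\sigma(\mu-\mu_j)}{\sigma(\mu-\mu_j)},\qquad \mu_j=\frac{j\pi}{\sigma}.$$ Then $\mu\mapsto\mu^{m-1}h_{kl}(\mu)$ belongs to $L^2(\mathbb R)$ and, with $\beta_3=\|\mu^{m-1}h_{kl}(\mu)\|_{L^2(\mathbb R)}$, for all integers $N\ge0$ and all real $\mu$ with $|\mu|<N\pi/\sigma$, $$\big|h_{kl}(\mu)-h_{kl}^{[N]}(\mu)\big|\le\frac{|\sin\sigma\mu|\,\beta_3}{\pi(\pi/\sigma)^{m-1}\sqrt{1-4^{-m+1}}}\left[\frac1{\sqrt{(N\pi/\sigma)-\mu}}+\frac1{\sqrt{(N\pi/\sigma)+\mu}}\right]\frac1{(N+1)^{m-1}}.$$ -/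

import Mathlib

open MeasureTheory

noncomputable section

/-- The entire function `sin z / z`, with its removable singularity filled in. -/
def csinc (z : ℂ) : ℂ := if z = 0 then 1 else Complex.sin z / z

/-- `y` is a (Carathéodory) solution on `[0, 1]` of `-y'' + q y = μ² y`, `y(0) = a`, `y'(0) = b`,
with derivative `dy`: `y` is differentiable on `[0, 1]` (one-sidedly at the end points) with
derivative `dy`, the function `dy` is absolutely continuous on `[0, 1]`, and the differential
equation holds almost everywhere. -/
structure IsSLSolution (q : ℝ → ℂ) (μ a b : ℂ) (y dy : ℝ → ℂ) : Prop where
  hasDeriv : ∀ x ∈ Set.Icc (0 : ℝ) 1, HasDerivWithinAt y (dy x) (Set.Icc 0 1) x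
  absCont : AbsolutelyContinuousOnInterval dy 0 1
  equation : ∀ᵐ x : ℝ, x ∈ Set.Ioo (0 : ℝ) 1 →
    ∃ d2y : ℂ, HasDerivAt dy d2y x ∧ -d2y + q x * y x = μ ^ 2 * y x
  init : y 0 = a
  init_deriv : dy 0 = b

/-- The functions `h_{kl}`, `k, l = 1, 2` (indexed here by `0, 1`), built from the regularizing
parameters `θ`, `m` and from `yc`, `yc'`, `ys`, `ys'`, where `yc μ x` stands for `y_c(x, μ)` and
similarly for the other three. -/
def hFun (θ : ℝ) (m : ℕ) (yc dyc ys dys : ℂ → ℝ → ℂ) (k l : Fin 2) (μ : ℂ) : ℂ :=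
  csinc (θ * μ) ^ m *
    (!![yc μ 1 - Complex.cos μ, ys μ 1 - csinc μ;
        dyc μ 1 + μ * Complex.sin μ, dys μ 1 - Complex.cos μ] : Matrix (Fin 2) (Fin 2) ℂ) k l

/-- The truncated cardinal series
`∑_{|j| ≤ N} f(μ_j) sin(σ(μ - μ_j)) / (σ(μ - μ_j))` with nodes `μ_j = jπ/σ`. -/
def cardinalTrunc (σ : ℝ) (N : ℕ) (f : ℂ → ℂ) (μ : ℂ) : ℂ :=
  ∑ j ∈ Finset.Icc (-(N : ℤ)) N,
    f ((j * Real.pi / σ : ℝ) : ℂ) * csinc (σ * (μ - ((j * Real.pi / σ : ℝ) : ℂ)))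

end

/-! Each `h_{kl}` is `(sin θμ / θμ)^m` times a remainder `E(μ)`, the difference between an endpoint
value for `q` and the one for `q = 0`. The remainder is entire with `|E(μ)| ≤ C e^{|Im μ|}`
(`differentiable_and_norm_le_of_hFun_entry`), so `h_{kl}` is entire of exponential type `σ = 1 + mθ`
and `O(|μ|^{-m})` on the real line.

Since `m ≥ 2`, `h_{kl}` equals its cardinal series (`HasQuadraticDecay.hasSum_csinc`). The function
`g = μ^{m-1} h_{kl}` is only `O(1/|μ|)`, which still gives `g ∈ L²` and `∑ |g(μ_j)|² ≤ (σ/π) β₃²`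
(`sum_sq_norm_le_integral_of_exp_type`). The truncation error is the tail `|j| > N`. There `sin σ(μ
- μ_j) = ± sin σμ`, the weight `|μ_j|^{-(m-1)}` is at most `((N+1)π/σ)^{-(m-1)}`, and Cauchy–Schwarz
pairs `g(μ_j)` with `1/(μ_j - μ)` (`norm_sub_cardinalTrunc_le`). The resulting bound lacks the
factor `1/√(1 - 4^{-m+1}) ≥ 1` and so is slightly stronger than required.

For the remainder: the Wronskian identity makes `q` integrable on all of `[0,1]`, the Volterra
equation with Grönwall gives the growth, and variation of parameters in `μ` gives holomorphy. -/

namespace Complex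

/-! ### Growth of sin, cos and sin z / z in the complex plane -/

theorem norm_exp_mul_I_le (z : ℂ) : ‖exp (z * I)‖ ≤ Real.exp |z.im| := by
  rw [norm_exp]
  simpa using neg_le_abs z.im

theorem norm_exp_neg_mul_I_le (z : ℂ) : ‖exp (-z * I)‖ ≤ Real.exp |z.im| := by
  simpa using norm_exp_mul_I_le (-z)

theorem norm_sin_le_exp_abs_im (z : ℂ) : ‖sin z‖ ≤ Real.exp |z.im| := by
  have h := norm_sub_le (exp (-z * I)) (exp (z * I))
  have h1 := norm_exp_mul_I_le z
  have h2 := norm_exp_neg_mul_I_le z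
  simp only [sin, norm_div, norm_mul, norm_I, mul_one, Complex.norm_ofNat]
  linarith

theorem norm_cos_le_exp_abs_im (z : ℂ) : ‖cos z‖ ≤ Real.exp |z.im| := by
  have h := norm_add_le (exp (z * I)) (exp (-z * I))
  have h1 := norm_exp_mul_I_le z
  have h2 := norm_exp_neg_mul_I_le z
  simp only [cos, norm_div, Complex.norm_ofNat]
  linarith

/-- Mean value inequality on the convex strip of points whose imaginary part is at most `|Im z|` in
modulus, which contains `0` and `z` and on which the derivative `cos` is at most `e^{|Im z|}`. -/
theorem norm_sin_le_norm_mul_exp_abs_im (z : ℂ) : ‖sin z‖ ≤ ‖z‖ * Real.exp |z.im| := by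
  have hc : Convex ℝ (im ⁻¹' Set.Icc (-|z.im|) |z.im|) :=
    (convex_Icc _ _).linear_preimage imLm
  have h := hc.norm_image_sub_le_of_norm_deriv_le (f := sin) (C := Real.exp |z.im|)
    (x := 0) (y := z) (fun x _ => differentiableAt_sin)
    (fun x hx => by
      rw [deriv_sin]
      refine (norm_cos_le_exp_abs_im x).trans (Real.exp_le_exp.2 ?_)
      exact abs_le.2 hx) (by simp) (by simp [neg_abs_le, le_abs_self])
  simpa [mul_comm] using h

end Complex

theorem mul_csinc (z : ℂ) : z * csinc z = Complex.sin z := by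
  by_cases h : z = 0
  · simp [h]
  · simp [csinc, h, mul_div_cancel₀]

theorem csinc_of_ne_zero {z : ℂ} (h : z ≠ 0) : csinc z = Complex.sin z / z := by
  simp [csinc, h]

theorem csinc_eq_dslope : csinc = dslope Complex.sin 0 := by
  ext z
  by_cases h : z = 0
  · simp [h, csinc]
  · simp [csinc, h, dslope_of_ne, slope_def_field]

theorem differentiable_csinc : Differentiable ℂ csinc := by
  rw [csinc_eq_dslope, ← differentiableOn_univ,
    Complex.differentiableOn_dslope Filter.univ_mem]
  exact Complex.differentiable_sin.differentiableOn

theorem norm_csinc_le (z : ℂ) : ‖csinc z‖ ≤ Real.exp |z.im| := by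
  by_cases h : z = 0
  · simp [h, csinc]
  · rw [csinc_of_ne_zero h, norm_div, div_le_iff₀ (norm_pos_iff.2 h), mul_comm]
    exact Complex.norm_sin_le_norm_mul_exp_abs_im z

/-- Sum of the bounds for `csinc z` and for `z * csinc z = sin z`. One power of decay per factor is
what the regularization exploits. -/
theorem norm_csinc_le_div (z : ℂ) : ‖csinc z‖ ≤ 2 * Real.exp |z.im| / (1 + ‖z‖) := by
  rw [le_div_iff₀ (by positivity)]
  have h1 := norm_csinc_le z
  have h2 := Complex.norm_sin_le_exp_abs_im z
  rw [← mul_csinc, norm_mul] at h2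
  linarith

theorem csinc_neg (z : ℂ) : csinc (-z) = csinc z := by
  by_cases h : z = 0
  · simp [h]
  · simp [csinc, h]

/-! ### Contour shift and Paley–Wiener support of the Fourier transform -/

open Filter Topology FourierTransform in
/-- Shifting the line of integration for a function decaying quadratically in a strip. -/
theorem integral_horizontal_eq {G : ℂ → ℂ} (hG : Differentiable ℂ G) (c M : ℝ)
    (hb : ∀ x y : ℝ, |y| ≤ |c| → ‖G (x + y * Complex.I)‖ ≤ M / (1 + x ^ 2)) :
    ∫ x : ℝ, G x = ∫ x : ℝ, G (x + c * Complex.I) := by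
  have hint : ∀ y : ℝ, |y| ≤ |c| → Integrable (fun x : ℝ => G (x + y * Complex.I)) := by
    intro y hy
    refine (integrable_inv_one_add_sq.const_mul M).mono' ?_ (ae_of_all _ fun x => ?_)
    · exact (hG.continuous.comp (by fun_prop)).aestronglyMeasurable
    · simpa [div_eq_mul_inv] using hb x y hy
  have h0 : Integrable (fun x : ℝ => G x) := by simpa using hint 0 (by simp)
  have t0 := intervalIntegral_tendsto_integral h0 tendsto_neg_atTop_atBot tendsto_id
  have t1 := intervalIntegral_tendsto_integral (hint c le_rfl) tendsto_neg_atTop_atBot tendsto_id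
  -- The vertical sides of the rectangle, right for `s = 1` and left for `s = -1`, contribute
  -- `O(1/T²)`.
  have hvert : ∀ s : ℝ, (s = 1 ∨ s = -1) →
      Tendsto (fun T : ℝ => ∫ y : ℝ in (0 : ℝ)..c, G (((s * T : ℝ) : ℂ) + y * Complex.I))
        atTop (𝓝 0) := by
    intro s hs
    have hs2 : s ^ 2 = 1 := by rcases hs with rfl | rfl <;> norm_num
    have hlim : Tendsto (fun T : ℝ => M / (1 + T ^ 2) * |c - 0|) atTop (𝓝 0) := by
      have h1 : Tendsto (fun T : ℝ => M / (1 + T ^ 2)) atTop (𝓝 0) := by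
        apply Tendsto.const_div_atTop
        exact tendsto_atTop_add_const_left _ _ (tendsto_pow_atTop two_ne_zero)
      simpa using h1.mul_const |c - 0|
    refine squeeze_zero_norm (fun T => ?_) hlim
    refine intervalIntegral.norm_integral_le_of_norm_le_const fun y hy => ?_
    have hy' : |y| ≤ |c| := by
      simpa using Set.abs_sub_left_of_mem_uIcc (Set.uIoc_subset_uIcc hy)
    have := hb (s * T) y hy'
    rwa [mul_pow, hs2, one_mul] at this
  have key : ∀ T : ℝ, (∫ x : ℝ in (-T)..T, G x) =
      (∫ x : ℝ in (-T)..T, G (x + c * Complex.I)) -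
        Complex.I * (∫ y : ℝ in (0 : ℝ)..c, G (((1 * T : ℝ) : ℂ) + y * Complex.I)) +
        Complex.I * (∫ y : ℝ in (0 : ℝ)..c, G (((-1 * T : ℝ) : ℂ) + y * Complex.I)) := by
    intro T
    have := Complex.integral_boundary_rect_eq_zero_of_differentiableOn G (-T)
      (T + c * Complex.I) hG.differentiableOn
    simp at this
    simp
    linear_combination this
  have t2 := ((t1.sub ((hvert 1 (Or.inl rfl)).const_mul Complex.I)).add
    ((hvert (-1) (Or.inr rfl)).const_mul Complex.I))
  simp only [id, mul_zero, sub_zero, add_zero] at t0 t1 t2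
  refine tendsto_nhds_unique t0 (t2.congr fun T => (key T).symm)

/-- Entire functions of exponential type `τ`, decaying quadratically on horizontal lines. -/
structure HasQuadraticDecay (τ : ℝ) (F : ℂ → ℂ) : Prop where
  differentiable : Differentiable ℂ F
  bound : ∃ C : ℝ, 0 ≤ C ∧ ∀ z : ℂ, ‖F z‖ ≤ C * Real.exp (τ * |z.im|) / (1 + z.re ^ 2)

namespace HasQuadraticDecay

variable {τ : ℝ} {F : ℂ → ℂ}

theorem continuous_ofReal (hF : HasQuadraticDecay τ F) : Continuous fun x : ℝ => F x :=
  hF.differentiable.continuous.comp Complex.continuous_ofReal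

theorem integrable (hF : HasQuadraticDecay τ F) : Integrable fun x : ℝ => F x := by
  obtain ⟨C, -, hC⟩ := hF.bound
  refine (integrable_inv_one_add_sq.const_mul C).mono'
    hF.continuous_ofReal.aestronglyMeasurable (ae_of_all _ fun x => ?_)
  simpa [div_eq_mul_inv] using hC x

-- Paley–Wiener: moving the line of integration to height `c` multiplies the bound by `e^{π|c| +
-- 2πξc}`. If `c` has the sign opposite to `ξ`, the exponent is `-π(2|ξ| - 1)|c|`, which tends to
-- `-∞`.
open FourierTransform Filter Topology in
theorem fourier_eq_zero (hF : HasQuadraticDecay Real.pi F) {ξ : ℝ} (hξ : 1 / 2 < |ξ|) :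
    𝓕 (fun x : ℝ => F x) ξ = 0 := by
  obtain ⟨C, hC0, hC⟩ := hF.bound
  have hexp : ∀ x c : ℝ, ‖Complex.exp (-2 * Real.pi * Complex.I * ξ * (x + c * Complex.I))‖
      = Real.exp (2 * Real.pi * ξ * c) := by
    intro x c
    rw [Complex.norm_exp]
    congr 1
    simp
  have main : ∀ c : ℝ, ‖𝓕 (fun x : ℝ => F x) ξ‖ ≤
      (C * Real.exp (Real.pi * |c| + 2 * Real.pi * ξ * c)) * Real.pi := by
    intro c
    set G : ℂ → ℂ := fun z => Complex.exp (-2 * Real.pi * Complex.I * ξ * z) * F z with hG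
    have hGn : ∀ x y : ℝ, ‖G (x + y * Complex.I)‖ ≤
        C * Real.exp (Real.pi * |y| + 2 * Real.pi * ξ * y) / (1 + x ^ 2) := by
      intro x y
      rw [hG, norm_mul, hexp, Real.exp_add]
      have := hC (x + y * Complex.I)
      simp only [Complex.add_im, Complex.ofReal_im, Complex.mul_im, Complex.ofReal_re,
        Complex.I_im, mul_one, Complex.I_re, mul_zero, add_zero, zero_add, Complex.add_re,
        Complex.mul_re, sub_self] at this
      calc _ ≤ Real.exp (2 * Real.pi * ξ * y) *
            (C * Real.exp (Real.pi * |y|) / (1 + x ^ 2)) := by gcongr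
        _ = _ := by ring
    have hshift : ∫ x : ℝ, G x = ∫ x : ℝ, G (x + c * Complex.I) := by
      refine integral_horizontal_eq (M := C * Real.exp (Real.pi * |c| + 2 * Real.pi * |ξ| * |c|))
        ?_ c fun x y hy => (hGn x y).trans ?_
      · have := hF.differentiable
        fun_prop
      · have h1 : ξ * y ≤ |ξ| * |c| :=
          (le_abs_self _).trans (by rw [abs_mul]; gcongr)
        have h2 : 2 * Real.pi * ξ * y ≤ 2 * Real.pi * |ξ| * |c| := by
          have := mul_le_mul_of_nonneg_left h1 Real.two_pi_pos.le
          linarith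
        gcongr
    have hfour : 𝓕 (fun x : ℝ => F x) ξ = ∫ x : ℝ, G x := by
      rw [Real.fourier_real_eq_integral_exp_smul]
      refine integral_congr_ae (ae_of_all _ fun x => ?_)
      simp only [hG, smul_eq_mul]
      congr 2
      push_cast
      ring
    rw [hfour, hshift]
    refine (norm_integral_le_of_norm_le (integrable_inv_one_add_sq.const_mul
      (C * Real.exp (Real.pi * |c| + 2 * Real.pi * ξ * c))) (ae_of_all _ fun x => ?_)).trans ?_
    · simpa [div_eq_mul_inv] using hGn x c
    · rw [integral_const_mul, integral_univ_inv_one_add_sq]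
  have hle : ∀ s : ℝ, 0 ≤ s → ‖𝓕 (fun x : ℝ => F x) ξ‖ ≤
      C * Real.exp (-(Real.pi * (2 * |ξ| - 1) * s)) * Real.pi := by
    intro s hs
    rcases le_total 0 ξ with h | h
    · refine (main (-s)).trans_eq ?_
      rw [abs_neg, abs_of_nonneg hs, abs_of_nonneg h]
      ring_nf
    · refine (main s).trans_eq ?_
      rw [abs_of_nonneg hs, abs_of_nonpos h]
      ring_nf
  have hpos : 0 < Real.pi * (2 * |ξ| - 1) := mul_pos Real.pi_pos (by linarith)
  have hlim : Tendsto (fun s : ℝ => C * Real.exp (-(Real.pi * (2 * |ξ| - 1) * s)) * Real.pi)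
      atTop (𝓝 0) := by
    have := Real.tendsto_exp_neg_atTop_nhds_zero.comp (tendsto_id.const_mul_atTop hpos)
    simpa using! (this.const_mul C).mul_const Real.pi
  have := ge_of_tendsto hlim ((eventually_ge_atTop 0).mono hle)
  exact norm_le_zero_iff.1 this

end HasQuadraticDecay

/-! ### Parseval's identity, the sampling theorem and Plancherel -/

open AddCircle in
/-- **Parseval's identity** in sesquilinear form, on the circle. -/
theorem hasSum_conj_mul_fourierCoeff {T : ℝ} [hT : Fact (0 < T)] {f g : AddCircle T → ℂ}
    (hf : MemLp f 2 haarAddCircle) (hg : MemLp g 2 haarAddCircle) :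
    HasSum (fun i => (starRingEnd ℂ) (fourierCoeff f i) * fourierCoeff g i)
      (∫ x, (starRingEnd ℂ) (f x) * g x ∂haarAddCircle) := by
  have h := fourierBasis.hasSum_inner_mul_inner (hf.toLp f) (hg.toLp g)
  have h1 : ∀ i, inner ℂ (hf.toLp f) (fourierBasis i) = (starRingEnd ℂ) (fourierCoeff f i) := by
    intro i
    rw [← fourierCoeff_congr_ae hf.coeFn_toLp, ← fourierBasis_repr,
      HilbertBasis.repr_apply_apply, inner_conj_symm]
  have h2 : ∀ i, inner ℂ (fourierBasis i) (hg.toLp g) = fourierCoeff g i := by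
    intro i
    rw [← fourierCoeff_congr_ae hg.coeFn_toLp, ← fourierBasis_repr,
      HilbertBasis.repr_apply_apply]
  simp only [h1, h2] at h
  convert! h using 1
  rw [L2.inner_def]
  apply integral_congr_ae
  filter_upwards [hf.coeFn_toLp, hg.coeFn_toLp] with x hx hy
  rw [hx, hy, RCLike.inner_apply']

/-- **Parseval's identity** in sesquilinear form, on an interval. -/
theorem hasSum_conj_mul_fourierCoeffOn {a b : ℝ} {f g : ℝ → ℂ} (hab : a < b)
    (hf : MemLp f 2 (volume.restrict (Set.Ioc a b)))
    (hg : MemLp g 2 (volume.restrict (Set.Ioc a b))) :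
    HasSum (fun i => (starRingEnd ℂ) (fourierCoeffOn hab f i) * fourierCoeffOn hab g i)
      ((b - a)⁻¹ • ∫ x in a..b, (starRingEnd ℂ) (f x) * g x) := by
  have : Fact (0 < b - a) := ⟨by linarith⟩
  have hb : a + (b - a) = b := by ring
  rw [← hb] at hf hg
  have h := hasSum_conj_mul_fourierCoeff hf.memLp_liftIoc.haarAddCircle
    hg.memLp_liftIoc.haarAddCircle
  have e : ∫ x in a..(a + (b - a)), (starRingEnd ℂ) (f x) * g x =
      ∫ x, (starRingEnd ℂ) (AddCircle.liftIoc (b - a) a f x) * AddCircle.liftIoc (b - a) a g x :=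
    (AddCircle.integral_liftIoc_eq_intervalIntegral (b - a)
      (f := fun x => (starRingEnd ℂ) (f x) * g x)).symm
  rw [AddCircle.integral_haarAddCircle, ← e, hb] at h
  exact h

theorem integral_exp_two_pi_mul_I_eq_csinc (t : ℝ) :
    ∫ ξ in (-(1 / 2) : ℝ)..1 / 2, Complex.exp (2 * Real.pi * Complex.I * t * ξ) =
      csinc (Real.pi * t) := by
  by_cases ht : t = 0
  · norm_num [ht, csinc]
  have hpi : (Real.pi : ℂ) ≠ 0 := by exact_mod_cast Real.pi_ne_zero
  have ht' : (t : ℂ) ≠ 0 := by exact_mod_cast ht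
  have hc : (2 * Real.pi * Complex.I * t : ℂ) ≠ 0 := by
    simp [ht, Real.pi_ne_zero, Complex.I_ne_zero]
  rw [integral_exp_mul_complex hc, csinc_of_ne_zero (mul_ne_zero hpi ht'), Complex.sin]
  have h1 : (2 * Real.pi * Complex.I * t : ℂ) * ((1 / 2 : ℝ) : ℂ) = Real.pi * t * Complex.I := by
    push_cast; ring
  have h2 : (2 * Real.pi * Complex.I * t : ℂ) * ((-(1 / 2) : ℝ) : ℂ) =
      -(Real.pi * t) * Complex.I := by
    push_cast; ring
  rw [h1, h2]
  field_simp
  rw [Complex.I_sq]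
  ring

namespace HasQuadraticDecay

variable {F : ℂ → ℂ}

open FourierTransform Filter Topology

theorem continuous_fourier (hF : HasQuadraticDecay Real.pi F) :
    Continuous (𝓕 fun x : ℝ => F x) := by
  exact VectorFourier.fourierIntegral_continuous Real.continuous_fourierChar
    (by exact continuous_inner) hF.integrable

theorem hasCompactSupport_fourier (hF : HasQuadraticDecay Real.pi F) :
    HasCompactSupport (𝓕 fun x : ℝ => F x) := by
  refine HasCompactSupport.intro (isCompact_Icc (a := -(1 / 2 : ℝ)) (b := 1 / 2)) fun ξ hξ => ?_
  refine hF.fourier_eq_zero ?_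
  by_contra h
  exact hξ (abs_le.1 (not_lt.1 h))

theorem integrable_fourier (hF : HasQuadraticDecay Real.pi F) :
    Integrable (𝓕 fun x : ℝ => F x) :=
  hF.continuous_fourier.integrable_of_hasCompactSupport hF.hasCompactSupport_fourier

theorem integral_mul_fourier_eq_intervalIntegral (hF : HasQuadraticDecay Real.pi F) (w : ℝ → ℂ) :
    ∫ ξ, w ξ * 𝓕 (fun x : ℝ => F x) ξ =
      ∫ ξ in (-(1 / 2) : ℝ)..1 / 2, w ξ * 𝓕 (fun x : ℝ => F x) ξ := by
  rw [intervalIntegral.integral_of_le (by norm_num), ← integral_Icc_eq_integral_Ioc,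
    setIntegral_eq_integral_of_forall_compl_eq_zero]
  intro ξ hξ
  rw [hF.fourier_eq_zero, mul_zero]
  by_contra h
  exact hξ (abs_le.1 (not_lt.1 h))

theorem eq_integral_fourier (hF : HasQuadraticDecay Real.pi F) (x : ℝ) :
    F x = ∫ ξ in (-(1 / 2) : ℝ)..1 / 2, Complex.exp (2 * Real.pi * Complex.I * x * ξ) *
      𝓕 (fun x : ℝ => F x) ξ := by
  rw [← hF.integral_mul_fourier_eq_intervalIntegral]
  have h := congrFun (hF.continuous_ofReal.fourierInv_fourier_eq hF.integrable
    hF.integrable_fourier) x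
  rw [← h, Real.fourierInv_eq_fourier_neg, Real.fourier_real_eq_integral_exp_smul]
  refine integral_congr_ae (ae_of_all _ fun ξ => ?_)
  simp only [smul_eq_mul]
  congr 2
  push_cast
  ring

/-- The integral defining the coefficient is Fourier inversion at the integer `-n`, because the
transform lives on one period. -/
theorem fourierCoeffOn_fourier (hF : HasQuadraticDecay Real.pi F)
    (hab : (-(1 / 2) : ℝ) < 1 / 2) (n : ℤ) :
    fourierCoeffOn hab (𝓕 fun x : ℝ => F x) n = F ((-n : ℤ) : ℝ) := by
  rw [fourierCoeffOn_eq_integral, hF.eq_integral_fourier, show (1 / (1 / 2 - -(1 / 2)) : ℝ) = 1 by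
    norm_num, one_smul]
  refine intervalIntegral.integral_congr fun ξ _ => ?_
  simp only [fourier_coe_apply, smul_eq_mul]
  congr 2
  push_cast
  ring

theorem memLp_fourier (hF : HasQuadraticDecay Real.pi F) :
    MemLp (𝓕 fun x : ℝ => F x) 2 (volume.restrict (Set.Ioc (-(1 / 2) : ℝ) (1 / 2))) :=
  (hF.continuous_fourier.memLp_of_hasCompactSupport hF.hasCompactSupport_fourier).restrict _

theorem hasSum_csinc_of_pi (hF : HasQuadraticDecay Real.pi F) (x : ℝ) :
    HasSum (fun n : ℤ => F (n : ℝ) * csinc (Real.pi * (x - (n : ℝ)))) (F x) := by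
  have hab : (-(1 / 2) : ℝ) < 1 / 2 := by norm_num
  -- Parseval conjugates its first argument, hence the sign of `x`: pairing `e` with the transform
  -- of `F` gives back `F x` by inversion.
  set e : ℝ → ℂ := fun ξ => Complex.exp (2 * Real.pi * Complex.I * (-x : ℝ) * ξ) with he
  have hec : Continuous e := by fun_prop
  have heL : MemLp e 2 (volume.restrict (Set.Ioc (-(1 / 2) : ℝ) (1 / 2))) := by
    refine MemLp.of_bound hec.aestronglyMeasurable 1 (ae_of_all _ fun ξ => ?_)
    rw [he, Complex.norm_exp]
    simp
  have hcoef : ∀ n : ℤ, fourierCoeffOn hab e n = csinc (Real.pi * ((-x - n : ℝ) : ℂ)) := by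
    intro n
    rw [fourierCoeffOn_eq_integral, ← integral_exp_two_pi_mul_I_eq_csinc,
      show (1 / (1 / 2 - -(1 / 2)) : ℝ) = 1 by norm_num, one_smul]
    refine intervalIntegral.integral_congr fun ξ _ => ?_
    simp only [fourier_coe_apply, he, smul_eq_mul]
    rw [← Complex.exp_add]
    congr 1
    push_cast
    ring
  have hreal : ∀ t : ℝ, (starRingEnd ℂ) (csinc (Real.pi * t)) = csinc (Real.pi * t) := by
    intro t
    by_cases h : (Real.pi * t : ℂ) = 0
    · simp [csinc, h]
    · rw [csinc_of_ne_zero h, map_div₀, ← Complex.sin_conj]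
      simp
  have h := hasSum_conj_mul_fourierCoeffOn hab heL hF.memLp_fourier
  have hval : ((1 / 2 - -(1 / 2) : ℝ))⁻¹ • ∫ ξ in (-(1 / 2) : ℝ)..1 / 2,
      (starRingEnd ℂ) (e ξ) * 𝓕 (fun x : ℝ => F x) ξ = F x := by
    rw [hF.eq_integral_fourier x, show ((1 / 2 - -(1 / 2))⁻¹ : ℝ) = 1 by norm_num, one_smul]
    refine intervalIntegral.integral_congr fun ξ _ => ?_
    simp only [he, ← Complex.exp_conj]
    congr 2
    simp [Complex.conj_ofNat]
  rw [hval] at h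
  rw [← (Equiv.neg ℤ).hasSum_iff] at h
  refine h.congr_fun fun n => ?_
  simp only [Function.comp_apply, Equiv.neg_apply, hcoef, hreal, hF.fourierCoeffOn_fourier hab,
    neg_neg]
  rw [← csinc_neg, mul_comm]
  congr 2
  push_cast
  ring

/-- Plancherel from the multiplication formula `∫ f̂ g = ∫ f ĝ` with `g` the conjugate of `f̂`: by
inversion, `ĝ` is then the conjugate of `f`. -/
theorem integral_sq_norm_fourier (hF : HasQuadraticDecay Real.pi F) :
    ∫ ξ in (-(1 / 2) : ℝ)..1 / 2, ‖𝓕 (fun x : ℝ => F x) ξ‖ ^ 2 = ∫ x : ℝ, ‖F x‖ ^ 2 := by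
  have hsq : ∀ z : ℂ, ((‖z‖ ^ 2 : ℝ) : ℂ) = z * (starRingEnd ℂ) z := fun z => by
    rw [Complex.mul_conj, Complex.normSq_eq_norm_sq]
  have h := VectorFourier.integral_fourierIntegral_smul_eq_flip (L := innerₗ ℝ)
    Real.continuous_fourierChar continuous_inner hF.integrable
    ((LinearIsometryEquiv.integrable_comp_iff Complex.conjLIE).2 hF.integrable_fourier)
  have h' : ∫ ξ, 𝓕 (fun x : ℝ => F x) ξ * (starRingEnd ℂ) (𝓕 (fun x : ℝ => F x) ξ) =
      ∫ x : ℝ, F x * 𝓕 (fun ξ => (starRingEnd ℂ) (𝓕 (fun x : ℝ => F x) ξ)) x := by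
    simpa [Function.comp_def] using! h
  have hconj : ∀ x : ℝ, 𝓕 (fun ξ => (starRingEnd ℂ) (𝓕 (fun x : ℝ => F x) ξ)) x =
      (starRingEnd ℂ) (F x) := by
    intro x
    rw [hF.eq_integral_fourier x, ← hF.integral_mul_fourier_eq_intervalIntegral, ← integral_conj,
      Real.fourier_real_eq_integral_exp_smul]
    refine integral_congr_ae (ae_of_all _ fun ξ => ?_)
    simp only [smul_eq_mul, map_mul, ← Complex.exp_conj]
    congr 2
    simp [Complex.conj_ofNat]
    ring
  simp only [hconj, mul_comm (𝓕 (fun x : ℝ => F x) _),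
    hF.integral_mul_fourier_eq_intervalIntegral] at h'
  apply Complex.ofReal_injective
  rw [← intervalIntegral.integral_ofReal, ← integral_complex_ofReal]
  simp only [hsq]
  rw [← h']
  simp only [mul_comm]

/-- **Plancherel–Pólya** at the critical density, for quadratically decaying functions. -/
theorem hasSum_sq_norm_of_pi (hF : HasQuadraticDecay Real.pi F) :
    HasSum (fun n : ℤ => ‖F (n : ℝ)‖ ^ 2) (∫ x : ℝ, ‖F x‖ ^ 2) := by
  have hab : (-(1 / 2) : ℝ) < 1 / 2 := by norm_num
  have h := hasSum_sq_fourierCoeffOn hab hF.memLp_fourier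
  rw [hF.integral_sq_norm_fourier, show ((1 / 2 - -(1 / 2))⁻¹ : ℝ) = 1 by norm_num, one_smul,
    ← (Equiv.neg ℤ).hasSum_iff] at h
  refine h.congr_fun fun n => ?_
  simp only [Function.comp_apply, Equiv.neg_apply, hF.fourierCoeffOn_fourier hab, neg_neg]

end HasQuadraticDecay

theorem inv_one_add_mul_sq_le {c : ℝ} (hc : c ≠ 0) (x : ℝ) :
    1 / (1 + (c * x) ^ 2) ≤ (1 + 1 / c ^ 2) / (1 + x ^ 2) := by
  have hc2 : 0 < c ^ 2 := by positivity
  rw [div_le_div_iff₀ (by positivity) (by positivity)]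
  have : (1 + 1 / c ^ 2) * (1 + (c * x) ^ 2) = 1 + c ^ 2 * x ^ 2 + 1 / c ^ 2 + x ^ 2 := by
    field_simp
    ring
  rw [this]
  have h1 : 0 ≤ c ^ 2 * x ^ 2 := by positivity
  have h2 : 0 ≤ 1 / c ^ 2 := by positivity
  linarith

namespace HasQuadraticDecay

variable {σ : ℝ} {F : ℂ → ℂ}

/-- Dilation by `π / σ` reduces type `σ` to type `π`, where the nodes are the integers. -/
theorem comp_mul (hF : HasQuadraticDecay σ F) {a τ : ℝ} (ha : 0 < a) (hτ : σ * a = τ) :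
    HasQuadraticDecay τ fun z => F (a * z) := by
  obtain ⟨C, hC0, hC⟩ := hF.bound
  refine ⟨hF.differentiable.comp (by fun_prop), C * (1 + 1 / a ^ 2), by positivity, fun z => ?_⟩
  refine (hC _).trans ?_
  have h := inv_one_add_mul_sq_le ha.ne' z.re
  rw [Complex.re_ofReal_mul, Complex.im_ofReal_mul, abs_mul, abs_of_pos ha, ← mul_assoc, hτ]
  calc _ = C * Real.exp (τ * |z.im|) * (1 / (1 + (a * z.re) ^ 2)) := by ring
    _ ≤ C * Real.exp (τ * |z.im|) * ((1 + 1 / a ^ 2) / (1 + z.re ^ 2)) := by gcongr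
    _ = _ := by ring

/-- **Whittaker–Shannon sampling theorem.** -/
theorem hasSum_csinc (hF : HasQuadraticDecay σ F) (hσ : 0 < σ) (x : ℝ) :
    HasSum (fun j : ℤ => F ((j * Real.pi / σ : ℝ) : ℂ) *
      csinc (σ * (x - ((j * Real.pi / σ : ℝ) : ℂ)))) (F x) := by
  have hσ' : (σ : ℂ) ≠ 0 := by exact_mod_cast hσ.ne'
  have hpi : (Real.pi : ℂ) ≠ 0 := by exact_mod_cast Real.pi_ne_zero
  have hH := hF.comp_mul (a := Real.pi / σ) (τ := Real.pi) (by positivity) (by field_simp)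
  have h := hH.hasSum_csinc_of_pi (x * σ / Real.pi)
  have hx : (((Real.pi / σ : ℝ) : ℂ) * ((x * σ / Real.pi : ℝ) : ℂ)) = x := by
    push_cast
    field_simp
  rw [hx] at h
  refine h.congr_fun fun j => ?_
  congr 2 <;> · push_cast; field_simp

theorem hasSum_sq_norm (hF : HasQuadraticDecay σ F) (hσ : 0 < σ) :
    HasSum (fun j : ℤ => ‖F ((j * Real.pi / σ : ℝ) : ℂ)‖ ^ 2)
      (σ / Real.pi * ∫ x : ℝ, ‖F x‖ ^ 2) := by
  have hH := hF.comp_mul (a := Real.pi / σ) (τ := Real.pi) (by positivity) (by field_simp)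
  have h := hH.hasSum_sq_norm_of_pi
  have hint : ∫ x : ℝ, ‖F (((Real.pi / σ : ℝ) : ℂ) * x)‖ ^ 2 =
      σ / Real.pi * ∫ x : ℝ, ‖F x‖ ^ 2 := by
    have := Measure.integral_comp_mul_left (fun x : ℝ => ‖F x‖ ^ 2) (Real.pi / σ)
    rw [abs_of_pos (by positivity), inv_div, smul_eq_mul] at this
    rw [← this]
    simp
  rw [hint] at h
  refine h.congr_fun fun j => ?_
  congr 3
  push_cast
  ring

end HasQuadraticDecay

/-! ### Plancherel–Pólya without quadratic decay -/

open Filter Topology in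
/-- **Plancherel–Pólya** at the critical density, for functions of exponential type `σ` that are
bounded and square integrable on the real line. -/
theorem sum_sq_norm_le_integral_of_exp_type {σ C : ℝ} {g : ℂ → ℂ} (hσ : 0 < σ)
    (hg : Differentiable ℂ g) (hC : ∀ z, ‖g z‖ ≤ C * Real.exp (σ * |z.im|))
    (hL2 : Integrable fun x : ℝ => ‖g x‖ ^ 2) (s : Finset ℤ) :
    ∑ j ∈ s, ‖g ((j * Real.pi / σ : ℝ) : ℂ)‖ ^ 2 ≤ σ / Real.pi * ∫ x : ℝ, ‖g x‖ ^ 2 := by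
  have hC0 : 0 ≤ C := by simpa using (norm_nonneg _).trans (hC 0)
  -- Dilation lowers the type to `(1 - ε)σ`. The squared `csinc` of type `εσ/2` uses up exactly the
  -- remaining `εσ` and supplies the quadratic decay.
  set G : ℝ → ℂ → ℂ := fun ε z => g (((1 - ε : ℝ) : ℂ) * z) *
    csinc (((ε * σ / 2 : ℝ) : ℂ) * z) ^ 2 with hG
  have hdecay : ∀ ε : ℝ, 0 < ε → ε < 1 → HasQuadraticDecay σ (G ε) := by
    intro ε h0 h1
    have hd := differentiable_csinc
    refine ⟨by fun_prop, C * 4 * (1 + 1 / (ε * σ / 2) ^ 2), by positivity, fun z => ?_⟩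
    set c := ε * σ / 2 with hc
    have hcpos : 0 < c := by positivity
    have e1 := hC (((1 - ε : ℝ) : ℂ) * z)
    have e2 := norm_csinc_le_div ((c : ℂ) * z)
    rw [Complex.im_ofReal_mul, abs_mul] at e1 e2
    rw [abs_of_pos (by linarith)] at e1
    rw [abs_of_pos hcpos, norm_mul, Complex.norm_real, Real.norm_of_nonneg hcpos.le] at e2
    have e3 : 1 / (1 + c * ‖z‖) ^ 2 ≤ (1 + 1 / c ^ 2) / (1 + z.re ^ 2) := by
      refine le_trans ?_ (inv_one_add_mul_sq_le hcpos.ne' z.re)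
      apply one_div_le_one_div_of_le (by positivity)
      have : (c * z.re) ^ 2 ≤ (c * ‖z‖) ^ 2 := by
        rw [mul_pow, mul_pow, ← sq_abs z.re]
        gcongr
        exact Complex.abs_re_le_norm z
      nlinarith [mul_nonneg hcpos.le (norm_nonneg z)]
    rw [hG, norm_mul, norm_pow]
    calc _ ≤ (C * Real.exp (σ * ((1 - ε) * |z.im|))) *
          (2 * Real.exp (c * |z.im|) / (1 + c * ‖z‖)) ^ 2 := by gcongr
      _ = C * 4 * (Real.exp (σ * ((1 - ε) * |z.im|)) *
          Real.exp (c * |z.im|) ^ 2) * (1 / (1 + c * ‖z‖) ^ 2) := by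
          generalize 1 + c * ‖z‖ = w
          ring
      _ = C * 4 * Real.exp (σ * |z.im|) * (1 / (1 + c * ‖z‖) ^ 2) := by
          rw [← Real.exp_nat_mul, ← Real.exp_add]
          congr 3
          rw [hc]
          push_cast
          ring
      _ ≤ C * 4 * Real.exp (σ * |z.im|) * ((1 + 1 / c ^ 2) / (1 + z.re ^ 2)) := by gcongr
      _ = _ := by ring
  have hbound : ∀ ε : ℝ, 0 < ε → ε < 1 → ∑ j ∈ s, ‖G ε ((j * Real.pi / σ : ℝ) : ℂ)‖ ^ 2 ≤
      σ / Real.pi * ((1 - ε)⁻¹ * ∫ x : ℝ, ‖g x‖ ^ 2) := by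
    intro ε h0 h1
    have hsum := (hdecay ε h0 h1).hasSum_sq_norm hσ
    refine (sum_le_hasSum s (fun _ _ => by positivity) hsum).trans ?_
    gcongr
    -- On the real line `|csinc| ≤ 1`, so only the change of variables costs a factor `(1 - ε)⁻¹`.
    have hcomp := Measure.integral_comp_mul_left (fun x : ℝ => ‖g x‖ ^ 2) (1 - ε)
    rw [abs_of_pos (by rw [inv_pos]; linarith), smul_eq_mul] at hcomp
    rw [← hcomp]
    refine integral_mono_of_nonneg (ae_of_all _ fun x => by positivity)
      (hL2.comp_mul_left' (by linarith)) (ae_of_all _ fun x => ?_)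
    simp only [hG, norm_mul, norm_pow]
    have : ‖csinc (((ε * σ / 2 : ℝ) : ℂ) * x)‖ ≤ 1 := by
      have := norm_csinc_le (((ε * σ / 2 : ℝ) : ℂ) * x)
      rw [← Complex.ofReal_mul] at this ⊢
      simpa only [Complex.ofReal_im, abs_zero, Real.exp_zero] using this
    rw [Complex.ofReal_mul]
    gcongr
    exact mul_le_of_le_one_right (norm_nonneg _) (pow_le_one₀ (norm_nonneg _) this)
  -- For a finite set of nodes, pointwise convergence as `ε → 0⁺` is enough.
  have hl : Tendsto (fun ε : ℝ => ∑ j ∈ s, ‖G ε ((j * Real.pi / σ : ℝ) : ℂ)‖ ^ 2) (𝓝[>] 0)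
      (𝓝 (∑ j ∈ s, ‖g ((j * Real.pi / σ : ℝ) : ℂ)‖ ^ 2)) := by
    have hc : Continuous fun ε : ℝ => ∑ j ∈ s, ‖G ε ((j * Real.pi / σ : ℝ) : ℂ)‖ ^ 2 := by
      have := hg.continuous
      have := differentiable_csinc.continuous
      fun_prop
    have := (hc.tendsto 0).mono_left (nhdsWithin_le_nhds (s := Set.Ioi 0))
    simpa [hG, csinc] using this
  have hr : Tendsto (fun ε : ℝ => σ / Real.pi * ((1 - ε)⁻¹ * ∫ x : ℝ, ‖g x‖ ^ 2)) (𝓝[>] 0)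
      (𝓝 (σ / Real.pi * ∫ x : ℝ, ‖g x‖ ^ 2)) := by
    have h1 : Tendsto (fun ε : ℝ => (1 - ε)⁻¹) (𝓝 0) (𝓝 1) := by
      have : Tendsto (fun ε : ℝ => 1 - ε) (𝓝 0) (𝓝 (1 - 0)) := by
        exact (continuous_const.sub continuous_id).tendsto 0
      simpa using this.inv₀ (by norm_num)
    simpa using ((h1.mono_left nhdsWithin_le_nhds).mul_const _).const_mul _
  refine le_of_tendsto_of_tendsto hl hr ?_
  filter_upwards [Ioo_mem_nhdsGT (show (0 : ℝ) < 1 by norm_num)] with ε hε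
  exact hbound ε hε.1 hε.2

/-! ### Absolutely continuous functions and the fundamental theorem of calculus -/

namespace AbsolutelyContinuousOnInterval

theorem comp_lipschitzWith_one {X Y : Type*} [PseudoMetricSpace X] [PseudoMetricSpace Y]
    {f : ℝ → X} {φ : X → Y} {a b : ℝ} (hφ : LipschitzWith 1 φ)
    (hf : AbsolutelyContinuousOnInterval f a b) :
    AbsolutelyContinuousOnInterval (fun x => φ (f x)) a b := by
  refine squeeze_zero (fun E => Finset.sum_nonneg fun _ _ => dist_nonneg) (fun E => ?_) hf
  exact Finset.sum_le_sum fun i _ => by simpa using hφ.dist_le_mul (f (E.2 i).1) (f (E.2 i).2)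

theorem intervalIntegrable_and_integral_eq_sub_of_real {f f' : ℝ → ℝ} {a b : ℝ} (hab : a ≤ b)
    (hf : AbsolutelyContinuousOnInterval f a b)
    (hd : ∀ᵐ x : ℝ, x ∈ Set.Ioo a b → HasDerivAt f (f' x) x) :
    IntervalIntegrable f' volume a b ∧ ∫ x in a..b, f' x = f b - f a := by
  have hne : ∀ᵐ x : ℝ, x ≠ b := by simp [ae_iff, measure_singleton]
  have hae : ∀ᵐ x : ℝ, x ∈ Set.uIoc a b → deriv f x = f' x := by
    filter_upwards [hd, hne] with x hx hxb hmem
    rw [Set.uIoc_of_le hab] at hmem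
    exact (hx ⟨hmem.1, lt_of_le_of_ne hmem.2 hxb⟩).deriv
  refine ⟨hf.intervalIntegrable_deriv.congr_ae ?_, ?_⟩
  · rwa [Filter.EventuallyEq, ae_restrict_iff' measurableSet_uIoc]
  · rw [← hf.integral_deriv_eq_sub]
    refine intervalIntegral.integral_congr_ae ?_
    filter_upwards [hae] with x hx hmem using (hx hmem).symm

/-- The fundamental theorem of calculus for complex valued absolutely continuous functions. -/
theorem intervalIntegrable_and_integral_eq_sub {f f' : ℝ → ℂ} {a b : ℝ} (hab : a ≤ b)
    (hf : AbsolutelyContinuousOnInterval f a b)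
    (hd : ∀ᵐ x : ℝ, x ∈ Set.Ioo a b → HasDerivAt f (f' x) x) :
    IntervalIntegrable f' volume a b ∧ ∫ x in a..b, f' x = f b - f a := by
  have hre := intervalIntegrable_and_integral_eq_sub_of_real (f := fun x => (f x).re)
    (f' := fun x => (f' x).re) hab
    (hf.comp_lipschitzWith_one (LipschitzWith.of_dist_le_mul fun z w => by
      simpa [Real.dist_eq, Complex.dist_eq] using Complex.abs_re_le_norm (z - w)))
    (by
      filter_upwards [hd] with x hx hmem
      exact (Complex.reCLM.hasFDerivAt.comp_hasDerivAt x (hx hmem)))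
  have him := intervalIntegrable_and_integral_eq_sub_of_real (f := fun x => (f x).im)
    (f' := fun x => (f' x).im) hab
    (hf.comp_lipschitzWith_one (LipschitzWith.of_dist_le_mul fun z w => by
      simpa [Real.dist_eq, Complex.dist_eq] using Complex.abs_im_le_norm (z - w)))
    (by
      filter_upwards [hd] with x hx hmem
      exact (Complex.imCLM.hasFDerivAt.comp_hasDerivAt x (hx hmem)))
  have i1 : IntervalIntegrable (fun x => ((f' x).re : ℂ)) volume a b :=
    ⟨hre.1.1.ofReal, hre.1.2.ofReal⟩
  have i2 : IntervalIntegrable (fun x => ((f' x).im : ℂ) * Complex.I) volume a b :=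
    IntervalIntegrable.mul_const ⟨him.1.1.ofReal, him.1.2.ofReal⟩ _
  have hsplit : f' = fun x => ((f' x).re : ℂ) + ((f' x).im : ℂ) * Complex.I := by
    ext x
    exact (Complex.re_add_im _).symm
  constructor
  · rw [hsplit]
    exact i1.add i2
  · rw [hsplit, intervalIntegral.integral_add i1 i2, intervalIntegral.integral_mul_const,
      intervalIntegral.integral_ofReal, intervalIntegral.integral_ofReal, hre.2, him.2]
    apply Complex.ext <;> simp

theorem of_hasDerivWithinAt {f f' : ℝ → ℂ} {a b : ℝ} (hab : a ≤ b)
    (hf : ∀ x ∈ Set.Icc a b, HasDerivWithinAt f (f' x) (Set.Icc a b) x)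
    (hf' : ContinuousOn f' (Set.Icc a b)) : AbsolutelyContinuousOnInterval f a b := by
  obtain ⟨C, hC⟩ := isCompact_Icc.exists_bound_of_continuousOn hf'
  refine LipschitzOnWith.absolutelyContinuousOnInterval (K := C.toNNReal) ?_
  rw [Set.uIcc_of_le hab]
  refine (convex_Icc a b).lipschitzOnWith_of_nnnorm_hasDerivWithin_le hf fun x hx => ?_
  rw [← NNReal.coe_le_coe, coe_nnnorm]
  exact (hC x hx).trans (Real.le_coe_toNNReal C)

end AbsolutelyContinuousOnInterval

/-! ### Lagrange's identity and the free solutions -/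

/-- A function on `[0, 1]` with absolutely continuous derivative `du` and second derivative `F`. -/
structure HasSecondDerivAE (u du F : ℝ → ℂ) : Prop where
  hasDeriv : ∀ x ∈ Set.Icc (0 : ℝ) 1, HasDerivWithinAt u (du x) (Set.Icc 0 1) x
  absCont : AbsolutelyContinuousOnInterval du 0 1
  hasDeriv₂ : ∀ᵐ x : ℝ, x ∈ Set.Ioo (0 : ℝ) 1 → HasDerivAt du (F x) x

namespace HasSecondDerivAE

variable {u du F v dv G : ℝ → ℂ}

theorem continuousOn_deriv (hu : HasSecondDerivAE u du F) : ContinuousOn du (Set.Icc 0 1) := by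
  simpa [Set.uIcc_of_le] using hu.absCont.continuousOn

theorem continuousOn (hu : HasSecondDerivAE u du F) : ContinuousOn u (Set.Icc 0 1) :=
  fun x hx => (hu.hasDeriv x hx).continuousWithinAt

theorem absolutelyContinuous (hu : HasSecondDerivAE u du F) :
    AbsolutelyContinuousOnInterval u 0 1 :=
  .of_hasDerivWithinAt zero_le_one hu.hasDeriv hu.continuousOn_deriv

theorem intervalIntegrable (hu : HasSecondDerivAE u du F) : IntervalIntegrable F volume 0 1 :=
  (hu.absCont.intervalIntegrable_and_integral_eq_sub zero_le_one hu.hasDeriv₂).1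

/-- **Lagrange's identity.** -/
theorem integral_lagrange (hu : HasSecondDerivAE u du F) (hv : HasSecondDerivAE v dv G) {x : ℝ}
    (hx : x ∈ Set.Icc (0 : ℝ) 1) :
    ∫ t in 0..x, (u t * G t - F t * v t) =
      (u x * dv x - du x * v x) - (u 0 * dv 0 - du 0 * v 0) := by
  -- The Wronskian is absolutely continuous, and the terms `u'v'` cancel in its derivative.
  have hac : AbsolutelyContinuousOnInterval (fun t => u t * dv t - du t * v t) 0 x := by
    refine AbsolutelyContinuousOnInterval.mono (a := 0) (b := 1) ?_ ?_
    · exact (hu.absolutelyContinuous.fun_smul hv.absCont).fun_sub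
        (hu.absCont.fun_smul hv.absolutelyContinuous)
    · rw [Set.uIcc_of_le hx.1, Set.uIcc_of_le zero_le_one]
      exact Set.Icc_subset_Icc_right hx.2
  refine (hac.intervalIntegrable_and_integral_eq_sub hx.1 ?_).2
  filter_upwards [hu.hasDeriv₂, hv.hasDeriv₂] with t h1 h2 ht
  have ht' : t ∈ Set.Ioo (0 : ℝ) 1 := ⟨ht.1, ht.2.trans_le hx.2⟩
  have hn : Set.Icc (0 : ℝ) 1 ∈ nhds t := Icc_mem_nhds ht'.1 ht'.2
  have d1 := (hu.hasDeriv t (Set.Ioo_subset_Icc_self ht')).hasDerivAt hn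
  have d2 := (hv.hasDeriv t (Set.Ioo_subset_Icc_self ht')).hasDerivAt hn
  have h : HasDerivAt (fun t => u t * dv t - du t * v t) _ t :=
    (d1.mul (h2 ht')).sub ((h1 ht').mul d2)
  refine h.congr_deriv ?_
  ring

end HasSecondDerivAE

theorem HasSecondDerivAE.of_hasDerivAt {u du F : ℝ → ℂ} (h1 : ∀ x, HasDerivAt u (du x) x)
    (h2 : ∀ x, HasDerivAt du (F x) x) (hF : Continuous F) : HasSecondDerivAE u du F where
  hasDeriv x _ := (h1 x).hasDerivWithinAt
  absCont := .of_hasDerivWithinAt zero_le_one (fun x _ => (h2 x).hasDerivWithinAt) hF.continuousOn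
  hasDeriv₂ := ae_of_all _ fun x _ => h2 x

theorem hasDerivAt_mul_csinc (μ : ℂ) (t : ℝ) :
    HasDerivAt (fun t : ℝ => (t : ℂ) * csinc (μ * t)) (Complex.cos (μ * t)) t := by
  have hid : HasDerivAt (fun t : ℝ => (t : ℂ)) 1 t := Complex.ofRealCLM.hasDerivAt
  by_cases h : μ = 0
  · simpa [h, csinc] using hid
  · have heq : (fun t : ℝ => (t : ℂ) * csinc (μ * t)) = fun t : ℝ => Complex.sin (μ * t) / μ := by
      ext t
      rw [← mul_csinc]
      field_simp
    rw [heq]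
    have h1 : HasDerivAt (fun t : ℝ => Complex.sin (μ * t)) (Complex.cos (μ * t) * (μ * 1)) t :=
      HasDerivAt.comp (h₂ := Complex.sin) t (Complex.hasDerivAt_sin (μ * t)) (hid.const_mul μ)
    refine (h1.div_const μ).congr_deriv ?_
    field_simp

theorem hasDerivAt_cos_mul_sub (μ : ℂ) (x t : ℝ) :
    HasDerivAt (fun t : ℝ => Complex.cos (μ * ((x - t : ℝ) : ℂ)))
      (μ * Complex.sin (μ * ((x - t : ℝ) : ℂ))) t := by
  have hid : HasDerivAt (fun t : ℝ => ((x - t : ℝ) : ℂ)) (-1) t := by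
    simpa using ((hasDerivAt_id t).const_sub x).ofReal_comp
  have h1 : HasDerivAt (fun t : ℝ => Complex.cos (μ * ((x - t : ℝ) : ℂ)))
      (-Complex.sin (μ * ((x - t : ℝ) : ℂ)) * (μ * -1)) t :=
    HasDerivAt.comp (h₂ := Complex.cos) t
      (Complex.hasDerivAt_cos (μ * ((x - t : ℝ) : ℂ))) (hid.const_mul μ)
  refine h1.congr_deriv ?_
  ring

theorem hasDerivAt_sin_mul_sub (μ : ℂ) (x t : ℝ) :
    HasDerivAt (fun t : ℝ => Complex.sin (μ * ((x - t : ℝ) : ℂ)))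
      (-(μ * Complex.cos (μ * ((x - t : ℝ) : ℂ)))) t := by
  have hid : HasDerivAt (fun t : ℝ => ((x - t : ℝ) : ℂ)) (-1) t := by
    simpa using ((hasDerivAt_id t).const_sub x).ofReal_comp
  have h1 : HasDerivAt (fun t : ℝ => Complex.sin (μ * ((x - t : ℝ) : ℂ)))
      (Complex.cos (μ * ((x - t : ℝ) : ℂ)) * (μ * -1)) t :=
    HasDerivAt.comp (h₂ := Complex.sin) t
      (Complex.hasDerivAt_sin (μ * ((x - t : ℝ) : ℂ))) (hid.const_mul μ)
  refine h1.congr_deriv ?_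
  ring

/-- Test function for Lagrange's identity: at `t = x` it has value `1` and derivative `0`, so the
boundary term isolates `y'(x)`. -/
theorem hasSecondDerivAE_cos (μ : ℂ) (x : ℝ) :
    HasSecondDerivAE (fun t : ℝ => Complex.cos (μ * ((x - t : ℝ) : ℂ)))
      (fun t : ℝ => μ * Complex.sin (μ * ((x - t : ℝ) : ℂ)))
      (fun t : ℝ => -μ ^ 2 * Complex.cos (μ * ((x - t : ℝ) : ℂ))) := by
  refine .of_hasDerivAt (hasDerivAt_cos_mul_sub μ x) (fun t => ?_) (by fun_prop)
  refine ((hasDerivAt_sin_mul_sub μ x t).const_mul μ).congr_deriv ?_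
  ring

/-- This is `sin(μ(x - t))/μ`, written so that `μ = 0` is included. At `t = x` it has value `0` and
derivative `-1`, so the boundary term isolates `y(x)`. -/
theorem hasSecondDerivAE_csinc (μ : ℂ) (x : ℝ) :
    HasSecondDerivAE (fun t : ℝ => ((x - t : ℝ) : ℂ) * csinc (μ * ((x - t : ℝ) : ℂ)))
      (fun t : ℝ => -Complex.cos (μ * ((x - t : ℝ) : ℂ)))
      (fun t : ℝ => -μ ^ 2 * (((x - t : ℝ) : ℂ) * csinc (μ * ((x - t : ℝ) : ℂ)))) := by
  refine .of_hasDerivAt (fun t => ?_) (fun t => ?_) ?_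
  · have hid : HasDerivAt (fun t : ℝ => x - t) (-1) t := by
      simpa using (hasDerivAt_id t).const_sub x
    have := (hasDerivAt_mul_csinc μ (x - t)).scomp t hid
    rw [neg_one_smul] at this
    exact this
  · refine (hasDerivAt_cos_mul_sub μ x t).neg.congr_deriv ?_
    rw [← mul_csinc]
    ring
  · have := differentiable_csinc.continuous
    fun_prop

/-! ### Grönwall's inequality -/

/-- Grönwall's inequality with an integrable kernel. -/
theorem le_mul_exp_integral_of_le_add_integral {κ w : ℝ → ℝ} {A : ℝ}
    (hκ : IntervalIntegrable κ volume 0 1) (hκ0 : ∀ t, 0 ≤ κ t)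
    (hw : ContinuousOn w (Set.Icc 0 1))
    (h : ∀ x ∈ Set.Icc (0 : ℝ) 1, w x ≤ A + ∫ t in 0..x, κ t * w t) {x : ℝ}
    (hx : x ∈ Set.Icc (0 : ℝ) 1) : w x ≤ A * Real.exp (∫ t in 0..x, κ t) := by
  have hκw : IntervalIntegrable (fun t => κ t * w t) volume 0 1 :=
    hκ.mul_continuousOn (by rwa [Set.uIcc_of_le zero_le_one])
  set U : ℝ → ℝ := fun x => A + ∫ t in 0..x, κ t * w t with hU
  set K : ℝ → ℝ := fun x => ∫ t in 0..x, κ t with hK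
  have hK0 : ∀ t ∈ Set.Icc (0 : ℝ) 1, 0 ≤ K t := fun t ht =>
    intervalIntegral.integral_nonneg ht.1 fun _ _ => hκ0 _
  -- Truncating at `0` makes `s ↦ e^{-s}` globally 1-Lipschitz. It changes nothing on the values of
  -- `K`, which are nonnegative on `[0,1]`.
  have hlip : LipschitzWith 1 fun s : ℝ => Real.exp (min (-s) 0) := by
    have h1 : LipschitzOnWith 1 Real.exp (Set.Iic 0) := by
      refine (convex_Iic 0).lipschitzOnWith_of_nnnorm_deriv_le
        (fun s _ => Real.differentiableAt_exp) fun s hs => ?_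
      rw [Real.deriv_exp, ← NNReal.coe_le_coe, coe_nnnorm, Real.norm_of_nonneg (Real.exp_nonneg _)]
      exact Real.exp_le_one_iff.2 hs
    have h2 : LipschitzWith 1 fun s : ℝ => min (-s) 0 := LipschitzWith.id.neg.min_const 0
    have := h1.comp (h2.lipschitzOnWith (s := Set.univ)) fun s _ =>
      Set.mem_Iic.2 (min_le_right (-s) 0)
    rw [one_mul, lipschitzOnWith_univ] at this
    exact this
  have hUac : AbsolutelyContinuousOnInterval U 0 1 := by
    refine AbsolutelyContinuousOnInterval.fun_add ?_
      (hκw.absolutelyContinuousOnInterval_intervalIntegral (c := 0) (by simp))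
    exact ((LipschitzWith.const A).lipschitzOnWith (s := _)).absolutelyContinuousOnInterval
  have hKac : AbsolutelyContinuousOnInterval K 0 1 :=
    hκ.absolutelyContinuousOnInterval_intervalIntegral (c := 0) (by simp)
  have hPac : AbsolutelyContinuousOnInterval (fun t => U t * Real.exp (min (-K t) 0)) 0 x := by
    refine AbsolutelyContinuousOnInterval.mono (a := 0) (b := 1)
      (hUac.fun_mul (hKac.comp_lipschitzWith_one
        (φ := fun s => Real.exp (min (-s) 0)) hlip)) ?_
    rw [Set.uIcc_of_le hx.1, Set.uIcc_of_le zero_le_one]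
    exact Set.Icc_subset_Icc_right hx.2
  have hPd : ∀ᵐ t : ℝ, t ∈ Set.Ioo (0 : ℝ) x → HasDerivAt (fun t => U t * Real.exp (min (-K t) 0))
      (κ t * w t * Real.exp (-K t) + U t * (Real.exp (-K t) * -κ t)) t := by
    filter_upwards [hκw.ae_hasDerivAt_integral, hκ.ae_hasDerivAt_integral] with t h1 h2 ht
    have ht' : t ∈ Set.Ioo (0 : ℝ) 1 := ⟨ht.1, ht.2.trans_le hx.2⟩
    have ht2 : t ∈ Set.uIcc (0 : ℝ) 1 := by
      rw [Set.uIcc_of_le zero_le_one]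
      exact Set.Ioo_subset_Icc_self ht'
    have d1 : HasDerivAt U (κ t * w t) t := (h1 ht2 0 (by simp)).const_add A
    have d2 : HasDerivAt K (κ t) t := h2 ht2 0 (by simp)
    refine (d1.mul d2.neg.exp).congr_of_eventuallyEq ?_
    filter_upwards [Ioo_mem_nhds ht'.1 ht'.2] with s hs
    have := hK0 s (Set.Ioo_subset_Icc_self hs)
    simp [min_eq_left (neg_nonpos.2 this)]
  have hint := (hPac.intervalIntegrable_and_integral_eq_sub_of_real hx.1 hPd).2
  -- The derivative of `U e^{-K}` is `κ (w - U) e^{-K} ≤ 0`, since `w ≤ U` is the hypothesis `h`.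
  have hneg : 0 ≤ ∫ t in 0..x,
      -(κ t * w t * Real.exp (-K t) + U t * (Real.exp (-K t) * -κ t)) := by
    refine intervalIntegral.integral_nonneg hx.1 fun t ht => ?_
    have h1 : w t ≤ U t := h t ⟨ht.1, ht.2.trans hx.2⟩
    have h2 : 0 ≤ κ t * Real.exp (-K t) := mul_nonneg (hκ0 t) (Real.exp_nonneg _)
    nlinarith [mul_le_mul_of_nonneg_left h1 h2]
  rw [intervalIntegral.integral_neg, hint] at hneg
  have hU0 : U 0 = A := by simp [hU]
  have hK00 : K 0 = 0 := by simp [hK]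
  rw [hU0, hK00, min_eq_left (neg_nonpos.2 (hK0 x hx))] at hneg
  simp only [neg_zero, min_self, Real.exp_zero, mul_one] at hneg
  have hfin : U x * Real.exp (-K x) ≤ A := by linarith
  rw [Real.exp_neg, ← div_eq_mul_inv, div_le_iff₀ (Real.exp_pos _)] at hfin
  exact (h x hx).trans hfin

/-! ### Solutions for fixed μ: integrability of q, Volterra equations, growth -/

namespace IsSLSolution

variable {q : ℝ → ℂ} {μ ν a b : ℂ} {y dy c dc s ds : ℝ → ℂ}

theorem hasSecondDerivAE (h : IsSLSolution q μ a b y dy) :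
    HasSecondDerivAE y dy fun x => (q x - μ ^ 2) * y x where
  hasDeriv := h.hasDeriv
  absCont := h.absCont
  hasDeriv₂ := by
    filter_upwards [h.equation] with x hx hmem
    obtain ⟨d, hd, he⟩ := hx hmem
    refine hd.congr_deriv ?_
    linear_combination -he

theorem wronskian_eq_one (hc : IsSLSolution q ν 1 0 c dc) (hs : IsSLSolution q ν 0 1 s ds) {x : ℝ}
    (hx : x ∈ Set.Icc (0 : ℝ) 1) : c x * ds x - dc x * s x = 1 := by
  have h := hc.hasSecondDerivAE.integral_lagrange hs.hasSecondDerivAE hx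
  have h0 : ∀ t, c t * ((q t - ν ^ 2) * s t) - (q t - ν ^ 2) * c t * s t = 0 := fun t => by ring
  simp only [h0, intervalIntegral.integral_zero, hc.init, hc.init_deriv, hs.init,
    hs.init_deriv] at h
  linear_combination -h

/-- The potential is integrable up to both end points as soon as the two basic initial value
problems at `0` have solutions. -/
theorem intervalIntegrable_potential (hc : IsSLSolution q ν 1 0 c dc)
    (hs : IsSLSolution q ν 0 1 s ds) : IntervalIntegrable q volume 0 1 := by
  have h01 : Set.uIcc (0 : ℝ) 1 = Set.Icc 0 1 := Set.uIcc_of_le zero_le_one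
  have h1 := hc.hasSecondDerivAE.intervalIntegrable.mul_continuousOn
    (by rw [h01]; exact hs.hasSecondDerivAE.continuousOn_deriv)
  have h2 := hs.hasSecondDerivAE.intervalIntegrable.mul_continuousOn
    (by rw [h01]; exact hc.hasSecondDerivAE.continuousOn_deriv)
  -- By the Wronskian identity, `q - ν² = (q - ν²)(c s' - c' s) = c'' s' - s'' c'`, with `c''`,
  -- `s''` integrable and `c'`, `s'` continuous on `[0,1]`.
  refine ((h1.sub h2).add (intervalIntegrable_const (c := ν ^ 2))).congr fun x hx => ?_
  have hx' : x ∈ Set.Icc (0 : ℝ) 1 := by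
    rw [← h01]
    exact Set.uIoc_subset_uIcc hx
  have := wronskian_eq_one hc hs hx'
  linear_combination (q x - ν ^ 2) * this

theorem deriv_eq_volterra (h : IsSLSolution q μ a b y dy) {x : ℝ} (hx : x ∈ Set.Icc (0 : ℝ) 1) :
    dy x = b * Complex.cos (μ * x) - a * (μ * Complex.sin (μ * x)) +
      ∫ t in 0..x, q t * y t * Complex.cos (μ * ((x - t : ℝ) : ℂ)) := by
  have hl := h.hasSecondDerivAE.integral_lagrange (hasSecondDerivAE_cos μ x) hx
  have he : ∀ t, y t * (-μ ^ 2 * Complex.cos (μ * ((x - t : ℝ) : ℂ))) -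
      (q t - μ ^ 2) * y t * Complex.cos (μ * ((x - t : ℝ) : ℂ)) =
      -(q t * y t * Complex.cos (μ * ((x - t : ℝ) : ℂ))) := fun t => by ring
  simp only [he, intervalIntegral.integral_neg, h.init, h.init_deriv, sub_self, sub_zero,
    Complex.ofReal_zero, mul_zero, Complex.cos_zero, Complex.sin_zero] at hl
  linear_combination hl

theorem eq_volterra (h : IsSLSolution q μ a b y dy) {x : ℝ} (hx : x ∈ Set.Icc (0 : ℝ) 1) :
    y x = a * Complex.cos (μ * x) + b * (x * csinc (μ * x)) +
      ∫ t in 0..x, q t * y t * (((x - t : ℝ) : ℂ) * csinc (μ * ((x - t : ℝ) : ℂ))) := by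
  have hl := h.hasSecondDerivAE.integral_lagrange (hasSecondDerivAE_csinc μ x) hx
  have he : ∀ t, y t * (-μ ^ 2 * (((x - t : ℝ) : ℂ) * csinc (μ * ((x - t : ℝ) : ℂ)))) -
      (q t - μ ^ 2) * y t * (((x - t : ℝ) : ℂ) * csinc (μ * ((x - t : ℝ) : ℂ))) =
      -(q t * y t * (((x - t : ℝ) : ℂ) * csinc (μ * ((x - t : ℝ) : ℂ)))) := fun t => by ring
  simp only [he, intervalIntegral.integral_neg, h.init, h.init_deriv, sub_self, sub_zero,
    Complex.ofReal_zero, mul_zero, Complex.cos_zero, zero_mul] at hl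
  linear_combination hl

theorem norm_mul_csinc_le {μ : ℂ} {x : ℝ} (h0 : 0 ≤ x) (h1 : x ≤ 1) :
    ‖(x : ℂ) * csinc (μ * x)‖ ≤ Real.exp (|μ.im| * x) := by
  have h := norm_csinc_le (μ * x)
  rw [Complex.im_mul_ofReal, abs_mul, abs_of_nonneg h0] at h
  rw [norm_mul, Complex.norm_real, Real.norm_of_nonneg h0]
  exact (mul_le_of_le_one_left (norm_nonneg _) h1).trans h

theorem norm_cos_mul_le {μ : ℂ} {x : ℝ} (h0 : 0 ≤ x) :
    ‖Complex.cos (μ * x)‖ ≤ Real.exp (|μ.im| * x) := by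
  have h := Complex.norm_cos_le_exp_abs_im (μ * x)
  rwa [Complex.im_mul_ofReal, abs_mul, abs_of_nonneg h0] at h

/-- Grönwall for `‖y(t)‖ e^{-τt}` with `τ = |Im μ|`: the Volterra kernel is at most `e^{τ(x-t)}`, so
the weight absorbs all dependence on `μ`. -/
theorem norm_le (h : IsSLSolution q μ a b y dy) (hq : IntervalIntegrable q volume 0 1) {x : ℝ}
    (hx : x ∈ Set.Icc (0 : ℝ) 1) :
    ‖y x‖ ≤ (‖a‖ + ‖b‖) * Real.exp (∫ t in (0 : ℝ)..1, ‖q t‖) * Real.exp (|μ.im| * x) := by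
  set τ := |μ.im| with hτ
  have hcont : ContinuousOn (fun t => ‖y t‖ * Real.exp (-(τ * t))) (Set.Icc 0 1) :=
    h.hasSecondDerivAE.continuousOn.norm.mul (by fun_prop)
  have hmono : ∀ x ∈ Set.Icc (0 : ℝ) 1, Set.uIcc 0 x ⊆ Set.uIcc (0 : ℝ) 1 := fun x hx => by
    rw [Set.uIcc_of_le hx.1, Set.uIcc_of_le zero_le_one]
    exact Set.Icc_subset_Icc_right hx.2
  have hstep : ∀ x ∈ Set.Icc (0 : ℝ) 1, ‖y x‖ * Real.exp (-(τ * x)) ≤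
      (‖a‖ + ‖b‖) + ∫ t in 0..x, ‖q t‖ * (‖y t‖ * Real.exp (-(τ * t))) := by
    intro x hx
    have hint : ‖∫ t in 0..x, q t * y t * (((x - t : ℝ) : ℂ) * csinc (μ * ((x - t : ℝ) : ℂ)))‖ ≤
        ∫ t in 0..x, ‖q t‖ * (‖y t‖ * Real.exp (-(τ * t))) * Real.exp (τ * x) := by
      refine intervalIntegral.norm_integral_le_of_norm_le hx.1 (ae_of_all _ fun t ht => ?_) ?_
      · rw [norm_mul, norm_mul, mul_assoc, mul_assoc, mul_assoc, ← Real.exp_add]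
        have := norm_mul_csinc_le (μ := μ) (x := x - t) (by linarith [ht.2])
          (by linarith [ht.1, hx.2])
        rw [show -(τ * t) + τ * x = τ * (x - t) by ring]
        gcongr
      · refine IntervalIntegrable.mul_const ?_ _
        exact (hq.norm.mul_continuousOn (by rwa [Set.uIcc_of_le zero_le_one])).mono_set
          (hmono x hx)
    rw [intervalIntegral.integral_mul_const] at hint
    have h1 := norm_cos_mul_le (μ := μ) hx.1
    have h2 := norm_mul_csinc_le (μ := μ) hx.1 hx.2
    rw [Real.exp_neg, ← div_eq_mul_inv, div_le_iff₀ (Real.exp_pos _), h.eq_volterra hx, add_mul]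
    refine (norm_add_le _ _).trans (add_le_add ((norm_add_le _ _).trans ?_) hint)
    rw [norm_mul, norm_mul, add_mul]
    gcongr
  have hG := le_mul_exp_integral_of_le_add_integral hq.norm (fun t => norm_nonneg (q t))
    hcont hstep hx
  rw [Real.exp_neg, ← div_eq_mul_inv, div_le_iff₀ (Real.exp_pos _)] at hG
  refine hG.trans ?_
  gcongr
  refine intervalIntegral.integral_mono_interval le_rfl hx.1 hx.2
    (ae_of_all _ fun t => norm_nonneg _) hq.norm

/-- The term `μ sin μ` must be removed before estimating. What remains is the Volterra integral,
whose integrand is bounded using `e^{τt} e^{τ(1-t)} = e^{τ}`, with `τ = |Im μ|`. -/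
theorem norm_deriv_sub_le (h : IsSLSolution q μ a b y dy) (hq : IntervalIntegrable q volume 0 1) :
    ‖dy 1 - (b * Complex.cos μ - a * (μ * Complex.sin μ))‖ ≤
      (∫ t in (0 : ℝ)..1, ‖q t‖) * ((‖a‖ + ‖b‖) * Real.exp (∫ t in (0 : ℝ)..1, ‖q t‖)) *
        Real.exp |μ.im| := by
  have hv := h.deriv_eq_volterra (x := 1) (by simp)
  rw [Complex.ofReal_one, mul_one] at hv
  rw [hv, add_sub_cancel_left, mul_assoc, ← intervalIntegral.integral_mul_const]
  refine intervalIntegral.norm_integral_le_of_norm_le zero_le_one (ae_of_all _ fun t ht => ?_)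
    (hq.norm.mul_const _)
  have h1 := h.norm_le hq (Set.Ioc_subset_Icc_self ht)
  have h2 := norm_cos_mul_le (μ := μ) (x := 1 - t) (by linarith [ht.2])
  rw [norm_mul, norm_mul, mul_assoc]
  refine mul_le_mul_of_nonneg_left ?_ (norm_nonneg _)
  calc _ ≤ (‖a‖ + ‖b‖) * Real.exp (∫ t in (0 : ℝ)..1, ‖q t‖) * Real.exp (|μ.im| * t) *
        Real.exp (|μ.im| * (1 - t)) := by gcongr
    _ = _ := by
      rw [mul_assoc _ (Real.exp (|μ.im| * t)), ← Real.exp_add, ← mul_add, add_sub_cancel, mul_one]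

theorem integral_mul_eq (h : IsSLSolution q μ a b y dy) {a' b' : ℂ} {z dz : ℝ → ℂ}
    (hz : IsSLSolution q ν a' b' z dz) {x : ℝ} (hx : x ∈ Set.Icc (0 : ℝ) 1) :
    (μ ^ 2 - ν ^ 2) * ∫ t in 0..x, y t * z t =
      (y x * dz x - dy x * z x) - (a * b' - b * a') := by
  have hl := h.hasSecondDerivAE.integral_lagrange hz.hasSecondDerivAE hx
  rw [h.init, h.init_deriv, hz.init, hz.init_deriv] at hl
  rw [← hl, ← intervalIntegral.integral_const_mul]
  refine intervalIntegral.integral_congr fun t _ => ?_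
  ring

/-- Variation of parameters in the spectral parameter. -/
theorem eq_variation (h : IsSLSolution q μ a b y dy) (hc : IsSLSolution q ν 1 0 c dc)
    (hs : IsSLSolution q ν 0 1 s ds) {x : ℝ} (hx : x ∈ Set.Icc (0 : ℝ) 1) :
    y x = a * c x + b * s x + (μ ^ 2 - ν ^ 2) *
      (c x * (∫ t in 0..x, y t * s t) - s x * ∫ t in 0..x, y t * c t) := by
  have hA := h.integral_mul_eq hc hx
  have hB := h.integral_mul_eq hs hx
  have hW := wronskian_eq_one hc hs hx
  -- `hA` and `hB` form a linear system in `y(x)`, `y'(x)` with determinant the Wronskian `1`; this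
  -- eliminates `y'(x)`.
  linear_combination -y x * hW - c x * hB + s x * hA

theorem deriv_eq_variation (h : IsSLSolution q μ a b y dy) (hc : IsSLSolution q ν 1 0 c dc)
    (hs : IsSLSolution q ν 0 1 s ds) {x : ℝ} (hx : x ∈ Set.Icc (0 : ℝ) 1) :
    dy x = a * dc x + b * ds x + (μ ^ 2 - ν ^ 2) *
      (dc x * (∫ t in 0..x, y t * s t) - ds x * ∫ t in 0..x, y t * c t) := by
  have hA := h.integral_mul_eq hc hx
  have hB := h.integral_mul_eq hs hx
  have hW := wronskian_eq_one hc hs hx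
  linear_combination -dy x * hW - dc x * hB + ds x * hA

end IsSLSolution

/-! ### Holomorphic dependence on μ and bounds for the remainder entries -/

namespace IsSLSolution

open Filter Topology

variable {q : ℝ → ℂ} {a b : ℂ} {yc dyc ys dys Y dY : ℂ → ℝ → ℂ}

theorem exists_norm_le_locally (hq : IntervalIntegrable q volume 0 1)
    (hY : ∀ μ, IsSLSolution q μ a b (Y μ) (dY μ)) (ν : ℂ) :
    ∃ M, 0 ≤ M ∧ ∀ᶠ μ in 𝓝 ν, ∀ x ∈ Set.Icc (0 : ℝ) 1, ‖Y μ x‖ ≤ M := by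
  refine ⟨(‖a‖ + ‖b‖) * Real.exp (∫ t in (0 : ℝ)..1, ‖q t‖) * Real.exp (|ν.im| + 1),
    by positivity, ?_⟩
  have hev : ∀ᶠ μ : ℂ in 𝓝 ν, |μ.im| < |ν.im| + 1 :=
    Complex.continuous_im.abs.continuousAt.eventually_lt_const (by simp)
  filter_upwards [hev] with μ hμ x hx
  refine ((hY μ).norm_le hq hx).trans ?_
  gcongr
  nlinarith [hx.1, hx.2, abs_nonneg μ.im]

theorem exists_norm_le_of_mem {μ : ℂ} {y dy : ℝ → ℂ}
    (h : IsSLSolution q μ a b y dy) :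
    ∃ M, 0 ≤ M ∧ ∀ x ∈ Set.Icc (0 : ℝ) 1, ‖y x‖ ≤ M := by
  obtain ⟨M, hM⟩ := isCompact_Icc.exists_bound_of_continuousOn h.hasSecondDerivAE.continuousOn
  exact ⟨M, (norm_nonneg _).trans (hM 0 (by simp)), hM⟩

/-- In the variation formula the factor `μ² - ν²` tends to `0` while the integrals stay bounded near
`ν`. -/
theorem tendsto_apply (hq : IntervalIntegrable q volume 0 1)
    (hY : ∀ μ, IsSLSolution q μ a b (Y μ) (dY μ)) {ν : ℂ} {c dc s ds : ℝ → ℂ}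
    (hc : IsSLSolution q ν 1 0 c dc) (hs : IsSLSolution q ν 0 1 s ds) {x : ℝ}
    (hx : x ∈ Set.Icc (0 : ℝ) 1) : Tendsto (fun μ => Y μ x) (𝓝 ν) (𝓝 (Y ν x)) := by
  obtain ⟨M, hM0, hM⟩ := exists_norm_le_locally hq hY ν
  obtain ⟨A, hA0, hA⟩ := hc.exists_norm_le_of_mem
  obtain ⟨B, hB0, hB⟩ := hs.exists_norm_le_of_mem
  have hint : ∀ {z : ℝ → ℂ} {D : ℝ}, (∀ x ∈ Set.Icc (0 : ℝ) 1, ‖z x‖ ≤ D) → 0 ≤ D → ∀ μ,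
      (∀ x ∈ Set.Icc (0 : ℝ) 1, ‖Y μ x‖ ≤ M) → ‖∫ t in 0..x, Y μ t * z t‖ ≤ M * D := by
    intro z D hz hD μ hμ
    refine (intervalIntegral.norm_integral_le_of_norm_le_const (C := M * D) fun t ht => ?_).trans ?_
    · rw [Set.uIoc_of_le hx.1] at ht
      have ht' : t ∈ Set.Icc (0 : ℝ) 1 := ⟨ht.1.le, ht.2.trans hx.2⟩
      rw [norm_mul]
      exact mul_le_mul (hμ t ht') (hz t ht') (norm_nonneg _) hM0
    · rw [sub_zero, abs_of_nonneg hx.1]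
      exact mul_le_of_le_one_right (by positivity) hx.2
  have hY0 : Y ν x = a * c x + b * s x := by
    simpa using (hY ν).eq_variation hc hs hx
  rw [hY0, tendsto_iff_norm_sub_tendsto_zero]
  have hlim : Tendsto (fun μ : ℂ => ‖μ ^ 2 - ν ^ 2‖ * (A * (M * B) + B * (M * A))) (𝓝 ν) (𝓝 0) := by
    have : Continuous fun μ : ℂ => ‖μ ^ 2 - ν ^ 2‖ * (A * (M * B) + B * (M * A)) := by fun_prop
    simpa using this.tendsto ν
  refine squeeze_zero' (Eventually.of_forall fun _ => norm_nonneg _) ?_ hlim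
  filter_upwards [hM] with μ hμ
  rw [(hY μ).eq_variation hc hs hx, add_sub_cancel_left, norm_mul]
  gcongr
  refine (norm_sub_le _ _).trans ?_
  rw [norm_mul, norm_mul]
  gcongr
  · exact hA x hx
  · exact hint hB hB0 μ hμ
  · exact hB x hx
  · exact hint hA hA0 μ hμ

theorem continuousAt_integral_mul (hq : IntervalIntegrable q volume 0 1)
    (hY : ∀ μ, IsSLSolution q μ a b (Y μ) (dY μ)) {ν : ℂ} {c dc s ds z : ℝ → ℂ}
    (hc : IsSLSolution q ν 1 0 c dc) (hs : IsSLSolution q ν 0 1 s ds)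
    (hz : ContinuousOn z (Set.Icc 0 1)) :
    ContinuousAt (fun μ => ∫ t in (0 : ℝ)..1, Y μ t * z t) ν := by
  obtain ⟨M, hM0, hM⟩ := exists_norm_le_locally hq hY ν
  have hsub : ∀ t ∈ Set.uIoc (0 : ℝ) 1, t ∈ Set.Icc (0 : ℝ) 1 := fun t ht => by
    rw [Set.uIoc_of_le zero_le_one] at ht
    exact Set.Ioc_subset_Icc_self ht
  refine intervalIntegral.continuousAt_of_dominated_interval (bound := fun t => M * ‖z t‖)
    (Eventually.of_forall fun μ => ?_) ?_ ?_ ?_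
  · exact (((hY μ).hasSecondDerivAE.continuousOn.mul hz).mono hsub).aestronglyMeasurable
      measurableSet_uIoc
  · filter_upwards [hM] with μ hμ
    refine ae_of_all _ fun t ht => ?_
    rw [norm_mul]
    gcongr
    exact hμ t (hsub t ht)
  · refine ContinuousOn.intervalIntegrable ?_
    rw [Set.uIcc_of_le zero_le_one]
    exact hz.norm.const_mul M
  · exact ae_of_all _ fun t ht =>
      ((tendsto_apply hq hY hc hs (hsub t ht)).mul_const (z t) : Tendsto _ _ _)

/-- A function with `f μ - f ν = (μ² - ν²) φ μ`, `φ` continuous at `ν`, is differentiable there. -/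
theorem differentiableAt_of_sub_eq {f φ : ℂ → ℂ} {ν : ℂ} (hφ : ContinuousAt φ ν)
    (h : ∀ μ, f μ = f ν + (μ ^ 2 - ν ^ 2) * φ μ) : DifferentiableAt ℂ f ν := by
  have hd : HasDerivAt f ((ν + ν) * φ ν) ν := by
    rw [hasDerivAt_iff_tendsto_slope]
    have hc : ContinuousAt (fun μ => (μ + ν) * φ μ) ν := by fun_prop
    refine (hc.tendsto.mono_left nhdsWithin_le_nhds).congr' ?_
    filter_upwards [self_mem_nhdsWithin] with μ hμ
    have hne : μ - ν ≠ 0 := sub_ne_zero.2 hμ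
    rw [slope_def_field, h μ]
    field_simp
    ring
  exact hd.differentiableAt

/-- The variation formula writes `Y μ 1 - Y ν 1` as `μ² - ν²` times a function of `μ` continuous at
`ν`, so a complex derivative exists at every `ν`. -/
theorem differentiable_endpoint (hyc : ∀ μ, IsSLSolution q μ 1 0 (yc μ) (dyc μ))
    (hys : ∀ μ, IsSLSolution q μ 0 1 (ys μ) (dys μ))
    (hY : ∀ μ, IsSLSolution q μ a b (Y μ) (dY μ)) : Differentiable ℂ fun μ => Y μ 1 := by
  intro ν
  have hq := intervalIntegrable_potential (hyc 0) (hys 0)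
  have hA := continuousAt_integral_mul hq hY (hyc ν) (hys ν)
    (hyc ν).hasSecondDerivAE.continuousOn
  have hB := continuousAt_integral_mul hq hY (hyc ν) (hys ν)
    (hys ν).hasSecondDerivAE.continuousOn
  refine differentiableAt_of_sub_eq ((hB.const_mul (yc ν 1)).sub (hA.const_mul (ys ν 1)))
    fun μ => ?_
  have h1 : (1 : ℝ) ∈ Set.Icc (0 : ℝ) 1 := by simp
  have e1 := (hY μ).eq_variation (hyc ν) (hys ν) h1
  have e2 := (hY ν).eq_variation (hyc ν) (hys ν) h1
  rw [sub_self, zero_mul, add_zero] at e2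
  rw [e1, e2]
  rfl

theorem differentiable_deriv_endpoint (hyc : ∀ μ, IsSLSolution q μ 1 0 (yc μ) (dyc μ))
    (hys : ∀ μ, IsSLSolution q μ 0 1 (ys μ) (dys μ))
    (hY : ∀ μ, IsSLSolution q μ a b (Y μ) (dY μ)) : Differentiable ℂ fun μ => dY μ 1 := by
  intro ν
  have hq := intervalIntegrable_potential (hyc 0) (hys 0)
  have hA := continuousAt_integral_mul hq hY (hyc ν) (hys ν)
    (hyc ν).hasSecondDerivAE.continuousOn
  have hB := continuousAt_integral_mul hq hY (hyc ν) (hys ν)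
    (hys ν).hasSecondDerivAE.continuousOn
  refine differentiableAt_of_sub_eq ((hB.const_mul (dyc ν 1)).sub (hA.const_mul (dys ν 1)))
    fun μ => ?_
  have h1 : (1 : ℝ) ∈ Set.Icc (0 : ℝ) 1 := by simp
  have e1 := (hY μ).deriv_eq_variation (hyc ν) (hys ν) h1
  have e2 := (hY ν).deriv_eq_variation (hyc ν) (hys ν) h1
  rw [sub_self, zero_mul, add_zero] at e2
  rw [e1, e2]
  rfl

end IsSLSolution

/-- The monodromy remainder entries are entire of exponential type `1`, and bounded on horizontal
lines. -/
theorem differentiable_and_norm_le_of_hFun_entry {q : ℝ → ℂ} {yc dyc ys dys : ℂ → ℝ → ℂ}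
    (hyc : ∀ μ, IsSLSolution q μ 1 0 (yc μ) (dyc μ))
    (hys : ∀ μ, IsSLSolution q μ 0 1 (ys μ) (dys μ)) (k l : Fin 2) :
    Differentiable ℂ (fun μ : ℂ =>
      (!![yc μ 1 - Complex.cos μ, ys μ 1 - csinc μ;
        dyc μ 1 + μ * Complex.sin μ, dys μ 1 - Complex.cos μ] : Matrix (Fin 2) (Fin 2) ℂ) k l) ∧
    ∃ C : ℝ, 0 ≤ C ∧ ∀ μ : ℂ,
      ‖(!![yc μ 1 - Complex.cos μ, ys μ 1 - csinc μ;
        dyc μ 1 + μ * Complex.sin μ, dys μ 1 - Complex.cos μ] : Matrix (Fin 2) (Fin 2) ℂ) k l‖ ≤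
        C * Real.exp |μ.im| := by
  have hq := IsSLSolution.intervalIntegrable_potential (hyc 0) (hys 0)
  have h1 : (1 : ℝ) ∈ Set.Icc (0 : ℝ) 1 := by simp
  have hQ : 0 ≤ ∫ t in (0 : ℝ)..1, ‖q t‖ :=
    intervalIntegral.integral_nonneg zero_le_one fun _ _ => norm_nonneg _
  set Q := ∫ t in (0 : ℝ)..1, ‖q t‖ with hQd
  have d1 := IsSLSolution.differentiable_endpoint hyc hys hyc
  have d2 := IsSLSolution.differentiable_endpoint hyc hys hys
  have d3 := IsSLSolution.differentiable_deriv_endpoint hyc hys hyc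
  have d4 := IsSLSolution.differentiable_deriv_endpoint hyc hys hys
  have d5 := differentiable_csinc
  fin_cases k <;> fin_cases l
  -- `exp Q` is the Grönwall constant, as `‖a‖ + ‖b‖ = 1`; the `1` bounds the free solution.
  · refine ⟨by simpa using d1.fun_sub Complex.differentiable_cos, Real.exp Q + 1, by positivity,
      fun μ => ?_⟩
    have e1 := (hyc μ).norm_le hq h1
    have e2 := Complex.norm_cos_le_exp_abs_im μ
    have e3 := norm_sub_le (yc μ 1) (Complex.cos μ)
    simp at e1 ⊢
    linarith
  · refine ⟨by simpa using d2.fun_sub d5, Real.exp Q + 1, by positivity, fun μ => ?_⟩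
    have e1 := (hys μ).norm_le hq h1
    have e2 := norm_csinc_le μ
    have e3 := norm_sub_le (ys μ 1) (csinc μ)
    simp at e1 ⊢
    linarith
  · refine ⟨by simpa using d3.fun_add (differentiable_id.fun_mul Complex.differentiable_sin),
      Q * Real.exp Q, by positivity, fun μ => ?_⟩
    have e1 := (hyc μ).norm_deriv_sub_le hq
    simpa using e1
  · refine ⟨by simpa using d4.fun_sub Complex.differentiable_cos, Q * Real.exp Q, by positivity,
      fun μ => ?_⟩
    have e1 := (hys μ).norm_deriv_sub_le hq
    simpa using e1

/-! ### Truncation error of the cardinal series -/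

/-- Telescoping: if `x_{n+1} = x_n + δ` with `x_n > 0`, then `1/x_{n+1}² ≤ 1/(x_n x_{n+1}) =
(1/δ)(1/x_n - 1/x_{n+1})`. -/
theorem sum_inv_sq_le {δ μ : ℝ} {N : ℕ} (hδ : 0 < δ) (hμ : μ < N * δ) (P : Finset ℤ)
    (hP : ∀ j ∈ P, (N : ℤ) < j) :
    ∑ j ∈ P, (1 / (j * δ - μ)) ^ 2 ≤ 1 / δ * (1 / (N * δ - μ)) := by
  have hx : 0 < N * δ - μ := by linarith
  have htel : ∀ n : ℕ, ∑ i ∈ Finset.range n, (1 / ((N + 1 + i) * δ - μ)) ^ 2 ≤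
      1 / δ * (1 / (N * δ - μ) - 1 / ((N + n) * δ - μ)) := by
    intro n
    induction n with
    | zero => simp
    | succ n ih =>
      rw [Finset.sum_range_succ]
      have hn : 0 ≤ n * δ := by positivity
      have h1 : 0 < (N + n) * δ - μ := by linarith
      have h2 : 0 < (N + 1 + n) * δ - μ := by linarith
      have key : (1 / ((N + 1 + n) * δ - μ)) ^ 2 ≤
          1 / δ * (1 / ((N + n) * δ - μ) - 1 / ((N + 1 + n) * δ - μ)) := by
        have : 1 / δ * (1 / ((N + n) * δ - μ) - 1 / ((N + 1 + n) * δ - μ)) =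
            1 / (((N + n) * δ - μ) * ((N + 1 + n) * δ - μ)) := by
          rw [div_sub_div _ _ h1.ne' h2.ne', one_mul, mul_one,
            show (N + 1 + n) * δ - μ - ((N + n) * δ - μ) = δ by ring]
          field_simp
        rw [this, div_pow, one_pow, pow_two]
        apply one_div_le_one_div_of_le (by positivity)
        gcongr
        linarith
      have hcast : ((N : ℝ) + (n + 1 : ℕ)) = N + 1 + n := by push_cast; ring
      rw [hcast]
      linarith
  set n := P.sup Int.toNat with hn
  have hinj : Function.Injective fun i : ℕ => (N : ℤ) + 1 + i := fun i j h => by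
    simpa using h
  have hsub : P ⊆ (Finset.range n).map ⟨fun i : ℕ => (N : ℤ) + 1 + i, hinj⟩ := by
    intro j hj
    have h1 := hP j hj
    have h2 : j.toNat ≤ n := Finset.le_sup (f := Int.toNat) hj
    rw [Finset.mem_map]
    refine ⟨(j - N - 1).toNat, Finset.mem_range.2 (by omega), ?_⟩
    simp only [Function.Embedding.coeFn_mk]
    omega
  refine (Finset.sum_le_sum_of_subset_of_nonneg hsub fun _ _ _ => by positivity).trans ?_
  rw [Finset.sum_map]
  have hcast : ∑ i ∈ Finset.range n, (1 / (((⟨fun i : ℕ => (N : ℤ) + 1 + i, hinj⟩ : ℕ ↪ ℤ) i : ℤ) *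
      δ - μ)) ^ 2 = ∑ i ∈ Finset.range n, (1 / ((N + 1 + i) * δ - μ)) ^ 2 := by
    refine Finset.sum_congr rfl fun i _ => ?_
    simp
  rw [hcast]
  refine (htel n).trans ?_
  have hn : 0 ≤ n * δ := by positivity
  have : 0 ≤ 1 / ((N + n) * δ - μ) := by
    apply div_nonneg zero_le_one
    linarith
  gcongr
  linarith

/-- The tail of a cardinal series, estimated through weighted square sums of its coefficients. -/
theorem sum_div_le_of_sum_sq_le {δ μ β : ℝ} {N k : ℕ} (hδ : 0 < δ) (hβ : 0 ≤ β)
    (hμ : μ < N * δ) {c : ℤ → ℝ} (hc : ∀ j, 0 ≤ c j)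
    (hsum : ∀ s : Finset ℤ, ∑ j ∈ s, ((j * δ) ^ k * c j) ^ 2 ≤ β ^ 2 / δ) (P : Finset ℤ)
    (hP : ∀ j ∈ P, (N : ℤ) < j) :
    ∑ j ∈ P, c j / (j * δ - μ) ≤
      β / (δ * δ ^ k) * (1 / √(N * δ - μ)) * (1 / ((N : ℝ) + 1) ^ k) := by
  have hx : 0 < N * δ - μ := by linarith
  have hN : 0 < (((N : ℝ) + 1) * δ) ^ k := by positivity
  -- Since `j ≥ N + 1`, inserting `(jδ)^k / ((N+1)δ)^k ≥ 1` costs nothing and prepares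
  -- Cauchy–Schwarz.
  have hterm : ∀ j ∈ P, c j / (j * δ - μ) ≤
      1 / (((N : ℝ) + 1) * δ) ^ k * (((j * δ) ^ k * c j) * (1 / (j * δ - μ))) := by
    intro j hj
    have h1 : ((N : ℝ) + 1) ≤ j := by exact_mod_cast hP j hj
    have h2 : 0 < j * δ - μ := by nlinarith
    have h3 : (((N : ℝ) + 1) * δ) ^ k ≤ (j * δ) ^ k := by gcongr
    have h4 : 0 ≤ c j * (1 / (j * δ - μ)) := mul_nonneg (hc j) (by positivity)
    rw [div_mul_eq_mul_div, one_mul, le_div_iff₀ hN]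
    calc _ = c j * (1 / (j * δ - μ)) * (((N : ℝ) + 1) * δ) ^ k := by ring
      _ ≤ c j * (1 / (j * δ - μ)) * (j * δ) ^ k := by gcongr
      _ = _ := by ring
  refine (Finset.sum_le_sum hterm).trans ?_
  rw [← Finset.mul_sum]
  have hcs := Real.sum_mul_le_sqrt_mul_sqrt P (fun j : ℤ => (j * δ) ^ k * c j)
    (fun j : ℤ => 1 / (j * δ - μ))
  have h1 : √(∑ j ∈ P, ((j * δ) ^ k * c j) ^ 2) ≤ √(β ^ 2 / δ) := Real.sqrt_le_sqrt (hsum P)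
  have h2 : √(∑ j ∈ P, (1 / (j * δ - μ)) ^ 2) ≤ √(1 / δ * (1 / (N * δ - μ))) :=
    Real.sqrt_le_sqrt (sum_inv_sq_le hδ hμ P hP)
  have h3 : √(β ^ 2 / δ) * √(1 / δ * (1 / (N * δ - μ))) = β / δ * (1 / √(N * δ - μ)) := by
    rw [Real.sqrt_div' _ hδ.le, Real.sqrt_sq hβ, Real.sqrt_mul (by positivity),
      Real.sqrt_div' _ hδ.le, Real.sqrt_div' _ hx.le, Real.sqrt_one]
    have : √δ * √δ = δ := Real.mul_self_sqrt hδ.le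
    calc _ = β / (√δ * √δ) * (1 / √(N * δ - μ)) := by ring
      _ = _ := by rw [this]
  have h4 := hcs.trans (mul_le_mul h1 h2 (Real.sqrt_nonneg _) (Real.sqrt_nonneg _))
  rw [h3] at h4
  calc _ ≤ 1 / (((N : ℝ) + 1) * δ) ^ k * (β / δ * (1 / √(N * δ - μ))) := by gcongr
    _ = _ := by
      rw [mul_pow]
      field_simp

/-- As `sin(σμ - jπ) = ± sin σμ`, the factor `|sin σμ|` is common to all terms of the tail. -/
theorem norm_csinc_node {σ μ : ℝ} (hσ : 0 < σ) {j : ℤ} (hne : μ ≠ j * Real.pi / σ) :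
    ‖csinc (σ * (μ - ((j * Real.pi / σ : ℝ) : ℂ)))‖ =
      |Real.sin (σ * μ)| / (σ * |μ - j * Real.pi / σ|) := by
  have h : (σ * (μ - ((j * Real.pi / σ : ℝ) : ℂ)) : ℂ) =
      ((σ * (μ - j * Real.pi / σ) : ℝ) : ℂ) := by push_cast; ring
  have hne' : σ * (μ - j * Real.pi / σ) ≠ 0 := mul_ne_zero hσ.ne' (sub_ne_zero.2 hne)
  rw [h, csinc_of_ne_zero (by exact_mod_cast hne'), norm_div, ← Complex.ofReal_sin,
    Complex.norm_real, Complex.norm_real, Real.norm_eq_abs, Real.norm_eq_abs, abs_mul,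
    abs_of_pos hσ]
  congr 1
  rw [show σ * (μ - j * Real.pi / σ) = σ * μ - j * Real.pi by field_simp, Real.sin_sub_int_mul_pi,
    abs_mul, abs_zpow]
  simp

/-- **Jagerman's truncation error estimate** for the cardinal series. -/
theorem norm_sub_cardinalTrunc_le {f : ℂ → ℂ} {σ β : ℝ} {k N : ℕ} {μ : ℝ} (hσ : 0 < σ)
    (hβ : 0 ≤ β)
    (hseries : HasSum (fun j : ℤ => f ((j * Real.pi / σ : ℝ) : ℂ) *
      csinc (σ * (μ - ((j * Real.pi / σ : ℝ) : ℂ)))) (f μ))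
    (hsum : ∀ s : Finset ℤ, ∑ j ∈ s,
      ‖((j * Real.pi / σ : ℝ) : ℂ) ^ k * f ((j * Real.pi / σ : ℝ) : ℂ)‖ ^ 2 ≤
        σ / Real.pi * β ^ 2)
    (hμ : |μ| < N * Real.pi / σ) :
    ‖f μ - cardinalTrunc σ N f μ‖ ≤
      |Real.sin (σ * μ)| * β / (Real.pi * (Real.pi / σ) ^ k) *
        (1 / √(N * Real.pi / σ - μ) + 1 / √(N * Real.pi / σ + μ)) *
        (1 / ((N : ℝ) + 1) ^ k) := by
  set δ := Real.pi / σ with hδd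
  have hδ : 0 < δ := by positivity
  have hnode : ∀ j : ℝ, j * Real.pi / σ = j * δ := fun j => mul_div_assoc _ _ _
  set c : ℤ → ℝ := fun j => ‖f ((j * Real.pi / σ : ℝ) : ℂ)‖ with hc
  have hc0 : ∀ j, 0 ≤ c j := fun j => norm_nonneg _
  have hσδ : σ / Real.pi * β ^ 2 = β ^ 2 / δ := by
    rw [hδd]
    field_simp
  have hsum1 : ∀ s : Finset ℤ, ∑ j ∈ s, ((j * δ) ^ k * c j) ^ 2 ≤ β ^ 2 / δ := by
    intro s
    rw [← hσδ]
    refine le_of_eq_of_le (Finset.sum_congr rfl fun j _ => ?_) (hsum s)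
    rw [norm_mul, norm_pow, Complex.norm_real, hnode, Real.norm_eq_abs, ← abs_pow,
      mul_pow |_|, sq_abs, ← mul_pow, hc]
    simp only [hnode]
  -- Reflection `j ↦ -j` carries the left tail at `μ` to a right tail at `-μ`; the sign of `jδ`
  -- disappears in the square.
  have hsum2 : ∀ s : Finset ℤ, ∑ j ∈ s, ((j * δ) ^ k * c (-j)) ^ 2 ≤ β ^ 2 / δ := by
    intro s
    refine le_of_eq_of_le ?_ (hsum1 (s.map (Equiv.neg ℤ).toEmbedding))
    rw [Finset.sum_map]
    refine Finset.sum_congr rfl fun j _ => ?_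
    simp only [Equiv.coe_toEmbedding, Equiv.neg_apply, Int.cast_neg, neg_mul]
    rw [mul_pow _ (c (-j)), mul_pow _ (c (-j)), ← sq_abs ((-(_ * δ)) ^ k), abs_pow, abs_neg,
      ← abs_pow, sq_abs]
  rw [hnode] at hμ ⊢
  obtain ⟨hμ1, hμ2⟩ := abs_lt.1 hμ
  set T : ℤ → ℂ := fun j => f ((j * Real.pi / σ : ℝ) : ℂ) *
      csinc (σ * (μ - ((j * Real.pi / σ : ℝ) : ℂ))) with hT
  have hpos : ∀ P : Finset ℤ, (∀ j ∈ P, (N : ℤ) < j) → ∑ j ∈ P, ‖T j‖ ≤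
      |Real.sin (σ * μ)| / σ *
        (β / (δ * δ ^ k) * (1 / √(N * δ - μ)) * (1 / ((N : ℝ) + 1) ^ k)) := by
    intro P hP
    refine le_trans (le_of_eq ?_) (mul_le_mul_of_nonneg_left
      (sum_div_le_of_sum_sq_le hδ hβ hμ2 hc0 hsum1 P hP) (by positivity))
    rw [Finset.mul_sum]
    refine Finset.sum_congr rfl fun j hj => ?_
    have h1 : (N : ℝ) ≤ j := by exact_mod_cast (hP j hj).le
    have h2 : 0 < j * δ - μ := by nlinarith
    rw [hT, norm_mul, norm_csinc_node hσ (by rw [hnode]; linarith), hnode, abs_sub_comm,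
      abs_of_pos h2, hc]
    simp only [hnode]
    field_simp
  have hneg : ∀ P : Finset ℤ, (∀ j ∈ P, j < -(N : ℤ)) → ∑ j ∈ P, ‖T j‖ ≤
      |Real.sin (σ * μ)| / σ *
        (β / (δ * δ ^ k) * (1 / √(N * δ + μ)) * (1 / ((N : ℝ) + 1) ^ k)) := by
    intro P hP
    have hmain := sum_div_le_of_sum_sq_le (c := fun j => c (-j)) hδ hβ (μ := -μ) (by linarith)
      (fun j => hc0 _) hsum2 (P.map (Equiv.neg ℤ).toEmbedding) (by
        intro j hj
        obtain ⟨i, hi, rfl⟩ := Finset.mem_map.1 hj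
        have := hP i hi
        simp only [Equiv.coe_toEmbedding, Equiv.neg_apply]
        omega)
    rw [Finset.sum_map, sub_neg_eq_add] at hmain
    refine le_trans (le_of_eq ?_) (mul_le_mul_of_nonneg_left hmain (by positivity))
    rw [Finset.mul_sum]
    refine Finset.sum_congr rfl fun j hj => ?_
    have h1 : (j : ℝ) ≤ -N := by exact_mod_cast (hP j hj).le
    have h2 : 0 < μ - j * δ := by nlinarith
    have h3 : -(j : ℝ) * δ - -μ = μ - j * δ := by ring
    rw [hT, norm_mul, norm_csinc_node hσ (by rw [hnode]; linarith), hnode,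
      abs_of_pos h2, hc]
    simp only [hnode, Equiv.coe_toEmbedding, Equiv.neg_apply, Int.cast_neg, neg_neg, h3]
    field_simp
  -- Bounds uniform over finite sets `S ⊇ [-N, N]` pass to the sum of the series.
  have hlim : Filter.Tendsto (fun S : Finset ℤ => ‖∑ j ∈ S, T j - cardinalTrunc σ N f μ‖)
      Filter.atTop (nhds ‖f μ - cardinalTrunc σ N f μ‖) :=
    (Filter.Tendsto.sub_const hseries _).norm
  refine le_of_tendsto hlim ?_
  filter_upwards [Filter.eventually_ge_atTop (Finset.Icc (-(N : ℤ)) N)] with S hS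
  have hsplit : ∑ j ∈ S, T j - cardinalTrunc σ N f μ = ∑ j ∈ S \ Finset.Icc (-(N : ℤ)) N, T j := by
    rw [← Finset.sum_sdiff hS, cardinalTrunc]
    exact add_sub_cancel_right _ _
  rw [hsplit]
  refine (norm_sum_le _ _).trans ?_
  rw [← Finset.sum_filter_add_sum_filter_not _ (fun j : ℤ => (N : ℤ) < j)]
  refine (add_le_add (hpos _ fun j hj => (Finset.mem_filter.1 hj).2)
    (hneg _ fun j hj => ?_)).trans (le_of_eq ?_)
  · simp only [Finset.mem_filter, Finset.mem_sdiff, Finset.mem_Icc] at hj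
    omega
  · have : σ * δ = Real.pi := by
      rw [hδd]
      field_simp
    rw [← this]
    field_simp

/-! ### The regularized functions and the conclusion -/

/-- Multiplying by powers of `csinc` regularizes entire functions of exponential type. -/
theorem norm_csinc_pow_mul_le {E : ℂ → ℂ} {C θ : ℝ} {m : ℕ} (hθ : 0 < θ)
    (hE : ∀ z, ‖E z‖ ≤ C * Real.exp |z.im|) (z : ℂ) :
    ‖csinc (θ * z) ^ m * E z‖ ≤
      2 ^ m * C * Real.exp ((1 + m * θ) * |z.im|) / (1 + θ * ‖z‖) ^ m := by
  have h := norm_csinc_le_div ((θ : ℂ) * z)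
  rw [Complex.im_ofReal_mul, abs_mul, abs_of_pos hθ, norm_mul, Complex.norm_real,
    Real.norm_of_nonneg hθ.le] at h
  rw [norm_mul, norm_pow]
  calc _ ≤ (2 * Real.exp (θ * |z.im|) / (1 + θ * ‖z‖)) ^ m * (C * Real.exp |z.im|) := by
        gcongr
        exact hE z
    _ = 2 ^ m * C * (Real.exp (θ * |z.im|) ^ m * Real.exp |z.im|) / (1 + θ * ‖z‖) ^ m := by
        rw [div_pow, mul_pow]
        ring
    _ = _ := by
        rw [← Real.exp_nat_mul, ← Real.exp_add]
        congr 3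
        ring

theorem one_add_mul_re_sq_le {θ : ℝ} (hθ : 0 ≤ θ) (z : ℂ) :
    1 + (θ * z.re) ^ 2 ≤ (1 + θ * ‖z‖) ^ 2 := by
  have : (θ * z.re) ^ 2 ≤ (θ * ‖z‖) ^ 2 := by
    rw [mul_pow, mul_pow, ← sq_abs z.re]
    gcongr
    exact Complex.abs_re_le_norm z
  nlinarith [mul_nonneg hθ (norm_nonneg z)]

theorem hasQuadraticDecay_csinc_pow_mul {E : ℂ → ℂ} {C θ : ℝ} {m : ℕ} (hθ : 0 < θ) (hm : 2 ≤ m)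
    (hd : Differentiable ℂ E) (hC : 0 ≤ C) (hE : ∀ z, ‖E z‖ ≤ C * Real.exp |z.im|) :
    HasQuadraticDecay (1 + m * θ) fun z => csinc (θ * z) ^ m * E z := by
  have hs := differentiable_csinc
  refine ⟨by fun_prop, 2 ^ m * C * (1 + 1 / θ ^ 2), by positivity, fun z => ?_⟩
  refine (norm_csinc_pow_mul_le hθ hE z).trans ?_
  have h1 : 1 / (1 + θ * ‖z‖) ^ m ≤ (1 + 1 / θ ^ 2) / (1 + z.re ^ 2) := by
    refine le_trans ?_ (inv_one_add_mul_sq_le hθ.ne' z.re)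
    apply one_div_le_one_div_of_le (by positivity)
    refine (one_add_mul_re_sq_le hθ.le z).trans (pow_le_pow_right₀ ?_ hm)
    have := mul_nonneg hθ.le (norm_nonneg z)
    linarith
  calc _ = 2 ^ m * C * Real.exp ((1 + m * θ) * |z.im|) * (1 / (1 + θ * ‖z‖) ^ m) := by ring
    _ ≤ 2 ^ m * C * Real.exp ((1 + m * θ) * |z.im|) * ((1 + 1 / θ ^ 2) / (1 + z.re ^ 2)) := by
        gcongr
    _ = _ := by ring

/-- The weight `z^{m-1}` uses up all but one of the `m` powers of decay: enough for boundedness and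
square integrability on the real line, not for `HasQuadraticDecay`. -/
theorem norm_pow_mul_csinc_pow_mul_le {E : ℂ → ℂ} {C θ : ℝ} {m : ℕ} (hθ : 0 < θ) (hm : 1 ≤ m)
    (hC : 0 ≤ C) (hE : ∀ z, ‖E z‖ ≤ C * Real.exp |z.im|) (z : ℂ) :
    ‖z ^ (m - 1) * (csinc (θ * z) ^ m * E z)‖ ≤
      2 ^ m * C / θ ^ (m - 1) * Real.exp ((1 + m * θ) * |z.im|) / (1 + θ * ‖z‖) := by
  obtain ⟨k, rfl⟩ : ∃ k, m = k + 1 := ⟨m - 1, by omega⟩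
  rw [norm_mul, norm_pow, Nat.add_sub_cancel]
  have hz : ‖z‖ ≤ (1 + θ * ‖z‖) / θ := by
    rw [le_div_iff₀ hθ]
    linarith
  refine (mul_le_mul (pow_le_pow_left₀ (norm_nonneg z) hz k) (norm_csinc_pow_mul_le hθ hE z)
    (norm_nonneg _) (by positivity)).trans (le_of_eq ?_)
  have hpos : 0 < 1 + θ * ‖z‖ := by positivity
  generalize 1 + θ * ‖z‖ = w at hpos
  rw [pow_succ w k, div_pow]
  field_simp

theorem memLp_pow_mul_csinc_pow_mul {E : ℂ → ℂ} {C θ : ℝ} {m : ℕ} (hθ : 0 < θ) (hm : 1 ≤ m)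
    (hd : Differentiable ℂ E) (hC : 0 ≤ C) (hE : ∀ z, ‖E z‖ ≤ C * Real.exp |z.im|) :
    MemLp (fun t : ℝ => (t : ℂ) ^ (m - 1) * (csinc (θ * t) ^ m * E t)) 2 volume := by
  have hs := differentiable_csinc.continuous
  have hE' := hd.continuous
  have hcont : Continuous fun t : ℝ => (t : ℂ) ^ (m - 1) * (csinc (θ * t) ^ m * E t) := by fun_prop
  rw [memLp_two_iff_integrable_sq_norm hcont.aestronglyMeasurable]
  set D := 2 ^ m * C / θ ^ (m - 1) with hD
  refine (integrable_inv_one_add_sq.const_mul (D ^ 2 * (1 + 1 / θ ^ 2))).mono'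
    (by fun_prop) (ae_of_all _ fun t => ?_)
  have h := norm_pow_mul_csinc_pow_mul_le hθ hm hC hE t
  rw [Complex.ofReal_im, abs_zero, mul_zero, Real.exp_zero, mul_one, ← hD] at h
  have h1 : 1 / (1 + θ * ‖(t : ℂ)‖) ^ 2 ≤ (1 + 1 / θ ^ 2) / (1 + t ^ 2) := by
    refine le_trans ?_ (inv_one_add_mul_sq_le hθ.ne' t)
    exact one_div_le_one_div_of_le (by positivity) (one_add_mul_re_sq_le hθ.le t)
  rw [norm_pow, norm_norm]
  calc _ ≤ (D / (1 + θ * ‖(t : ℂ)‖)) ^ 2 := by gcongr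
    _ = D ^ 2 * (1 / (1 + θ * ‖(t : ℂ)‖) ^ 2) := by
        rw [div_pow]
        ring
    _ ≤ D ^ 2 * ((1 + 1 / θ ^ 2) / (1 + t ^ 2)) := by gcongr
    _ = _ := by ring

theorem sq_toReal_eLpNorm_two {f : ℝ → ℂ} (hf : MemLp f 2 volume) :
    (eLpNorm f 2 volume).toReal ^ 2 = ∫ x, ‖f x‖ ^ 2 := by
  rw [hf.eLpNorm_eq_integral_rpow_norm two_ne_zero ENNReal.ofNat_ne_top,
    ENNReal.toReal_ofReal (Real.rpow_nonneg (integral_nonneg fun x => by positivity) _)]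
  have h0 : 0 ≤ ∫ x, ‖f x‖ ^ 2 := integral_nonneg fun x => by positivity
  simp only [ENNReal.toReal_ofNat, Real.rpow_ofNat]
  rw [← Real.rpow_natCast, ← Real.rpow_mul h0]
  norm_num

theorem lemma2p5 (q : ℝ → ℂ) (hq : LocallyIntegrableOn q (Set.Ioo (0 : ℝ) 1) volume)
    (yc dyc ys dys : ℂ → ℝ → ℂ)
    (hyc : ∀ μ : ℂ, IsSLSolution q μ 1 0 (yc μ) (dyc μ))
    (hys : ∀ μ : ℂ, IsSLSolution q μ 0 1 (ys μ) (dys μ))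
    (θ : ℝ) (hθ : 0 < θ) (m : ℕ) (hm : 2 ≤ m) (σ : ℝ) (hσ : σ = 1 + m * θ) (k l : Fin 2) :
    MemLp (fun t : ℝ => (t : ℂ) ^ (m - 1) * hFun θ m yc dyc ys dys k l t) 2 volume ∧
    ∀ (N : ℕ) (μ : ℝ), |μ| < N * Real.pi / σ →
      ‖hFun θ m yc dyc ys dys k l μ - cardinalTrunc σ N (hFun θ m yc dyc ys dys k l) μ‖ ≤
        |Real.sin (σ * μ)| *
            (eLpNorm (fun t : ℝ => (t : ℂ) ^ (m - 1) * hFun θ m yc dyc ys dys k l t)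
              2 volume).toReal /
          (Real.pi * (Real.pi / σ) ^ (m - 1) * √(1 - ((4 : ℝ) ^ (m - 1))⁻¹)) *
        (1 / √(N * Real.pi / σ - μ) + 1 / √(N * Real.pi / σ + μ)) *
        (1 / ((N : ℝ) + 1) ^ (m - 1)) := by
  obtain ⟨hd, C, hC, hE⟩ := differentiable_and_norm_le_of_hFun_entry hyc hys k l
  have hmem := memLp_pow_mul_csinc_pow_mul hθ (m := m) (by omega) hd hC hE
  refine ⟨hmem, fun N μ hμ => ?_⟩
  have hσ0 : 0 < σ := by
    rw [hσ]
    positivity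
  have hdecay := hasQuadraticDecay_csinc_pow_mul hθ hm hd hC hE
  rw [← hσ] at hdecay
  have hs := differentiable_csinc
  have hbound := fun z : ℂ =>
    (norm_pow_mul_csinc_pow_mul_le hθ (m := m) (by omega) hC hE z).trans
      (div_le_self (by positivity) (le_add_of_nonneg_right (by positivity : 0 ≤ θ * ‖z‖)))
  rw [← hσ] at hbound
  have hsum := sum_sq_norm_le_integral_of_exp_type hσ0 (by fun_prop) hbound
    ((memLp_two_iff_integrable_sq_norm hmem.aestronglyMeasurable).1 hmem)
  rw [← sq_toReal_eLpNorm_two hmem] at hsum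
  refine (norm_sub_cardinalTrunc_le (f := hFun θ m yc dyc ys dys k l) (k := m - 1) hσ0
    ENNReal.toReal_nonneg (hdecay.hasSum_csinc hσ0 μ) hsum hμ).trans ?_
  -- The estimate is already proved with the larger denominator; `0 < √(1 - 4^{-(m-1)}) ≤ 1` only
  -- weakens it.
  have h4 : (1 : ℝ) < 4 ^ (m - 1) := one_lt_pow₀ (by norm_num) (by omega)
  have h5 : 0 < √(1 - ((4 : ℝ) ^ (m - 1))⁻¹) :=
    Real.sqrt_pos.2 (sub_pos.2 (inv_lt_one_of_one_lt₀ h4))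
  have h6 : √(1 - ((4 : ℝ) ^ (m - 1))⁻¹) ≤ 1 :=
    Real.sqrt_le_one.2 (by linarith [inv_pos.2 (zero_lt_one.trans h4)])
  have h7 : Real.pi * (Real.pi / σ) ^ (m - 1) * √(1 - ((4 : ℝ) ^ (m - 1))⁻¹) ≤
      Real.pi * (Real.pi / σ) ^ (m - 1) := mul_le_of_le_one_right (by positivity) h6
  have h8 : 0 ≤ (eLpNorm (fun t : ℝ => (t : ℂ) ^ (m - 1) * hFun θ m yc dyc ys dys k l t)
    2 volume).toReal := ENNReal.toReal_nonneg
  refine mul_le_mul_of_nonneg_right (mul_le_mul_of_nonneg_right ?_ (by positivity))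
    (by positivity)
  exact div_le_div_of_nonneg_left (mul_nonneg (abs_nonneg _) h8) (by positivity) h7
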